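/- **Setting.** Let $\mathscr F=\{f_\theta:\theta\in\Theta\}$, $\Theta\subseteq\mathbb R^p$ open, be a family of probability densities with respect to a $\sigma$-finite measure $\mu$ (written $dx$) on a measurable space, and let $B$ be a strictly convex function on $(0,\infty)$ that is three times differentiable. Let $m:\mathbb R^p\to\mathbb R^r$, $r<p$, be such that the $p\times r$ matrix $M(\theta)=\partial m(\theta)^T/\partial\theta$ exists, is continuous in $\theta$ and has rank $r$ on $\Theta$. Let $X_1,X_2,\dots$ be i.i.d. with distribution $G$ of density $g=f_{\theta_0}$, where $\theta_0\in\Theta$ and $m(\theta_0)=0$ (the true distribution belongs to the model and satisfies the restrictions). With $\chi$ the common support in (A1), put (all integrals $dx$ are over $\chi$) $$u_\theta(x)=\nabla_\theta\log f_\theta(x),\quad I_\theta(x)=-\nabla_\theta u_\theta(x),\quad w(t)=B''(t)\,t,\quad h(x)=\frac{w'(f_\theta(x))f_\theta(x)}{w(f_\theta(x))},$$ $$V_\theta(t)=\int[f_\theta B'(f_\theta)-B(f_\theta)]\,dx-B'(f_\theta(t)),\qquad \psi(x,\theta)=u_\theta(x)B''(f_\theta(x))f_\theta(x)-\int u_\theta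 B''(f_\theta)f_\theta^2\,dt,$$ $$\xi(\theta)=\int u_\theta B''(f_\theta)f_\theta\,dG,\qquad K(\theta)=\int u_\theta u_\theta^T[B''(f_\theta)f_\theta]^2\,dG-\xi(\theta)\xi(\theta)^T,$$ $$J(\theta)=\int u_\theta u_\theta^TB''(f_\theta)f_\theta^2\,dx+\int[I_\theta-u_\theta u_\theta^Th]\,[g-f_\theta]\,B''(f_\theta)f_\theta\,dx .$$ **Assumptions.** The integrals defining $K(\theta_0)$ are finite, and there is an open set $\omega\subseteq\Theta$ containing $\theta_0$ such that: - (A1) $\{x:f_\theta(x)>0\}=\chi$ for every $\theta\in\Theta$, and $\{x:g(x)>0\}=\chi$. - (A2) For almost all $x\in\chi$, $\theta\mapsto f_\theta(x)$ is three times differentiable on $\omega$, with continuous third partial derivatives. - (A3) On $\omega$, the integrals $\int[f_\theta B'(f_\theta)-B(f_\theta)]\,dx$ and $\int B'(f_\theta)\,g\,dx$ can be differentiated three times with respect to $\theta$, under the integral sign. - (A4) The matrix with entries $E_g[\nabla_{kl}V_{\theta}(X)]$ at $\theta=\theta_0$ is positive definite. - (A5) For all $j,k,l$ there is a function $M_{jkl}$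 with $E_g[M_{jkl}(X)]<\infty$ and $|\nabla_{jkl}V_\theta(x)|\le M_{jkl}(x)$ for all $\theta\in\omega$. - (A6) For all $j,k,l$ the partial derivatives $\partial^2m_l(\theta)/\partial\theta_j\partial\theta_k$ exist and are bounded on $\omega$. Call $\theta\in\Theta$ a root of the restricted minimum Bregman divergence estimating equation for $X_1,\dots,X_n$ if $m(\theta)=0$ and $n^{-1}\sum_{i=1}^n\psi(X_i,\theta)+M(\theta)\lambda=0$ for some $\lambda\in\mathbb R^r$. **Conclusion.** 1. The restricted estimating equation has a consistent sequence of roots: there are measurable functions $\tilde\theta_n=\tilde\theta_n(X_1,\dots,X_n)$ that are roots with probability tending to $1$ and converge to $\theta_0$ in probability. 2. For every such sequence $\tilde\theta_n$ (and, more generally, for every sequence of random vectors $\tilde\theta_n$ with these two properties), $\sqrt n(\tilde\theta_n-\theta_0)$ converges in distribution to $N_p(0,PKP)$, where $P=J^{-1}-QM^TJ^{-1}$ and $Q=J^{-1}M(M^TJ^{-1}M)^{-1}$, with $J,K,M$ evaluated at $\theta_0$. -/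

import Mathlib

open MeasureTheory ProbabilityTheory Filter Topology

noncomputable section

namespace Bregman

/-- The ambient space `ℝᵖ` of the parameter. -/
abbrev E (p : ℕ) : Type := EuclideanSpace ℝ (Fin p)

/-- The partial derivative `∂F/∂θ_k` at `θ`. -/
def partialDeriv {p : ℕ} (k : Fin p) (F : E p → ℝ) (θ : E p) : ℝ :=
  lineDeriv ℝ F θ (EuclideanSpace.single k 1)

/-- The partial derivative in `θ_k` of a function of a parameter `θ` and a point `x`. -/
def paramDeriv {p : ℕ} {𝒳 : Type*} (k : Fin p) (φ : E p → 𝒳 → ℝ) : E p → 𝒳 → ℝ :=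
  fun θ x => partialDeriv k (fun θ' => φ θ' x) θ

/-- `DiffUnderIntegral ν N n φ`: for `θ` in `N`, the integral `∫ φ_θ dν` exists, it has all partial
derivatives in `θ` up to order `n`, and these can be taken under the integral sign. -/
def DiffUnderIntegral {p : ℕ} {𝒳 : Type*} [MeasurableSpace 𝒳] (ν : Measure 𝒳) (N : Set (E p)) :
    ℕ → (E p → 𝒳 → ℝ) → Prop
  | 0, φ => ∀ θ ∈ N, Integrable (φ θ) ν
  | n + 1, φ =>
      (∀ θ ∈ N, Integrable (φ θ) ν) ∧
      ∀ k : Fin p,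
        (∀ᵐ x ∂ν, ∀ θ ∈ N,
          LineDifferentiableAt ℝ (fun θ' => φ θ' x) θ (EuclideanSpace.single k 1)) ∧
        (∀ θ ∈ N, HasLineDerivAt ℝ (fun θ' => ∫ x, φ θ' x ∂ν) (∫ x, paramDeriv k φ θ x ∂ν) θ
          (EuclideanSpace.single k 1)) ∧
        DiffUnderIntegral ν N n (paramDeriv k φ)

/-- A function `B` that generates a Bregman divergence: strictly convex, with three derivatives on
the range `(0, ∞)` of a positive density. -/
structure IsGenerator (B : ℝ → ℝ) : Prop where
  strictConvexOn : StrictConvexOn ℝ (Set.Ioi 0) B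
  differentiableAt : ∀ t > 0, DifferentiableAt ℝ B t
  differentiableAt_deriv : ∀ t > 0, DifferentiableAt ℝ (deriv B) t
  differentiableAt_deriv_deriv : ∀ t > 0, DifferentiableAt ℝ (deriv (deriv B)) t

/-- The weight function `w(t) = B''(t) t`. -/
def weight (B : ℝ → ℝ) (t : ℝ) : ℝ := deriv (deriv B) t * t

/-- A parametric family of probability densities `f_θ`, `θ ∈ Θ`, with respect to a `σ`-finite
measure `μ`, where the parameter space `Θ ⊆ ℝᵖ` is open. -/
structure Model (p : ℕ) (𝒳 : Type*) [MeasurableSpace 𝒳] where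
  /-- the dominating measure -/
  μ : Measure 𝒳
  sigmaFinite : SigmaFinite μ
  /-- the parameter space -/
  Θ : Set (E p)
  isOpen : IsOpen Θ
  /-- the densities -/
  f : E p → 𝒳 → ℝ
  measurable : ∀ θ ∈ Θ, Measurable (f θ)
  nonneg : ∀ θ ∈ Θ, ∀ x, 0 ≤ f θ x
  lintegral_eq_one : ∀ θ ∈ Θ, ∫⁻ x, ENNReal.ofReal (f θ x) ∂μ = 1

namespace Model

variable {p : ℕ} {𝒳 : Type*} [MeasurableSpace 𝒳] (𝓕 : Model p 𝒳)

/-- The set `χ` on which the densities of the family live; under a common support it is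
`{x | f_θ(x) > 0}` for each `θ`. -/
def χ : Set 𝒳 := {x | ∃ θ ∈ 𝓕.Θ, 0 < 𝓕.f θ x}

/-- The measure `dx` on `χ`. -/
def base : Measure 𝒳 := 𝓕.μ.restrict 𝓕.χ

/-- The distribution with density `g` with respect to `μ`. -/
def dist (g : 𝒳 → ℝ) : Measure 𝒳 := 𝓕.μ.withDensity (fun x => ENNReal.ofReal (g x))

/-- The likelihood score `u_θ(x) = ∇_θ log f_θ(x)`. -/
def score (θ : E p) (x : 𝒳) (k : Fin p) : ℝ :=
  paramDeriv k (fun θ' x' => Real.log (𝓕.f θ' x')) θ x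

/-- The information function `I_θ(x) = -∇_θ u_θ(x)`. -/
def info (θ : E p) (x : 𝒳) : Matrix (Fin p) (Fin p) ℝ :=
  Matrix.of fun k l => -paramDeriv l (fun θ' x' => 𝓕.score θ' x' k) θ x

/-- `f_θ(x) B'(f_θ(x)) - B(f_θ(x))`. -/
def modelTerm (B : ℝ → ℝ) (θ : E p) (x : 𝒳) : ℝ :=
  𝓕.f θ x * deriv B (𝓕.f θ x) - B (𝓕.f θ x)

/-- `V_θ(t) = ∫ [f_θ B'(f_θ) - B(f_θ)] dx - B'(f_θ(t))`. -/
def V (B : ℝ → ℝ) (θ : E p) (t : 𝒳) : ℝ :=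
  (∫ x, 𝓕.modelTerm B θ x ∂𝓕.base) - deriv B (𝓕.f θ t)

/-- `ψ(x, θ) = u_θ(x) B''(f_θ(x)) f_θ(x) - ∫ u_θ(t) B''(f_θ(t)) f_θ(t)² dt`. -/
def psi (B : ℝ → ℝ) (x : 𝒳) (θ : E p) (k : Fin p) : ℝ :=
  𝓕.score θ x k * deriv (deriv B) (𝓕.f θ x) * 𝓕.f θ x
    - ∫ t, 𝓕.score θ t k * deriv (deriv B) (𝓕.f θ t) * 𝓕.f θ t ^ 2 ∂𝓕.base

/-- `ξ(θ) = ∫ u_θ B''(f_θ) f_θ dG`, where `G` has density `g`. -/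
def ξ (B : ℝ → ℝ) (g : 𝒳 → ℝ) (θ : E p) (k : Fin p) : ℝ :=
  ∫ x, 𝓕.score θ x k * weight B (𝓕.f θ x) ∂𝓕.dist g

/-- `K(θ) = ∫ u_θ u_θᵀ [B''(f_θ) f_θ]² dG - ξ(θ) ξ(θ)ᵀ`. -/
def K (B : ℝ → ℝ) (g : 𝒳 → ℝ) (θ : E p) : Matrix (Fin p) (Fin p) ℝ :=
  Matrix.of fun k l =>
    (∫ x, 𝓕.score θ x k * 𝓕.score θ x l * weight B (𝓕.f θ x) ^ 2 ∂𝓕.dist g)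
      - 𝓕.ξ B g θ k * 𝓕.ξ B g θ l

/-- The integrals that define `K(θ)` are finite. -/
def FiniteK (B : ℝ → ℝ) (g : 𝒳 → ℝ) (θ : E p) : Prop :=
  ∀ k l, Integrable (fun x => 𝓕.score θ x k * 𝓕.score θ x l * weight B (𝓕.f θ x) ^ 2) (𝓕.dist g)

/-- `h(x) = w'(f_θ(x)) f_θ(x) / w(f_θ(x))`, where `w'(t) = B''(t) + B'''(t) t`. -/
def h (B : ℝ → ℝ) (θ : E p) (x : 𝒳) : ℝ :=
  (deriv (deriv B) (𝓕.f θ x) + deriv (deriv (deriv B)) (𝓕.f θ x) * 𝓕.f θ x) * 𝓕.f θ x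
    / weight B (𝓕.f θ x)

/-- `J(θ) = ∫ u uᵀ B''(f) f² dx + ∫ [I - u uᵀ h] (g - f) B''(f) f dx` at `f = f_θ`. -/
def J (B : ℝ → ℝ) (g : 𝒳 → ℝ) (θ : E p) : Matrix (Fin p) (Fin p) ℝ :=
  Matrix.of fun k l =>
    (∫ x, 𝓕.score θ x k * 𝓕.score θ x l * deriv (deriv B) (𝓕.f θ x) * 𝓕.f θ x ^ 2 ∂𝓕.base)
      + ∫ x, (𝓕.info θ x k l - 𝓕.score θ x k * 𝓕.score θ x l * 𝓕.h B θ x)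
          * (g x - 𝓕.f θ x) * weight B (𝓕.f θ x) ∂𝓕.base

/-- The matrix of the expectations `E_g[∇_{kl} V_θ(X)]`. -/
def hessianV (B : ℝ → ℝ) (g : 𝒳 → ℝ) (θ : E p) : Matrix (Fin p) (Fin p) ℝ :=
  Matrix.of fun k l => ∫ x, paramDeriv k (paramDeriv l (𝓕.V B)) θ x ∂𝓕.dist g

/-- (A1) The model densities and the true density `g` have the common support `χ`. -/
def A1 (g : 𝒳 → ℝ) : Prop :=
  (∀ θ ∈ 𝓕.Θ, {x | 0 < 𝓕.f θ x} = 𝓕.χ) ∧ {x | 0 < g x} = 𝓕.χ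

/-- (A2) For almost all `x ∈ χ`, the density `f_θ(x)` has continuous partial derivatives of order
three with respect to `θ ∈ N`. -/
def A2 (N : Set (E p)) : Prop :=
  ∀ᵐ x ∂𝓕.base, ContDiffOn ℝ 3 (fun θ => 𝓕.f θ x) N

/-- (A3) The integrals `∫ [f_θ B'(f_θ) - B(f_θ)] dx` and `∫ B'(f_θ) g dx` can be differentiated
three times under the integral sign. -/
def A3 (B : ℝ → ℝ) (g : 𝒳 → ℝ) (N : Set (E p)) : Prop :=
  DiffUnderIntegral 𝓕.base N 3 (𝓕.modelTerm B) ∧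
  DiffUnderIntegral 𝓕.base N 3 (fun θ x => deriv B (𝓕.f θ x) * g x)

/-- (A4) The matrix `E_g[∇_{kl} V_θ(X)]` is positive definite at the target parameter `θ₀`. -/
def A4 (B : ℝ → ℝ) (g : 𝒳 → ℝ) (θ₀ : E p) : Prop :=
  (𝓕.hessianV B g θ₀).PosDef

/-- (A5) The third partial derivatives of `V_θ` are dominated on `N` by integrable functions. -/
def A5 (B : ℝ → ℝ) (g : 𝒳 → ℝ) (N : Set (E p)) : Prop :=
  ∀ j k l : Fin p, ∃ D : 𝒳 → ℝ, Integrable D (𝓕.dist g) ∧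
    ∀ᵐ x ∂𝓕.dist g, ∀ θ ∈ N,
      |paramDeriv j (paramDeriv k (paramDeriv l (𝓕.V B))) θ x| ≤ D x

end Model

variable {p r : ℕ}

/-- The `p × r` matrix `M(θ) = ∂ m(θ)ᵀ / ∂θ`, whose `(j, l)` entry is `∂m_l(θ)/∂θ_j`. -/
def constraintMatrix (m : E p → Fin r → ℝ) (θ : E p) : Matrix (Fin p) (Fin r) ℝ :=
  Matrix.of fun j l => partialDeriv j (fun θ' => m θ' l) θ

/-- (A6) The second partial derivatives of the components of `m` exist and are bounded on `N`. -/
def A6 (m : E p → Fin r → ℝ) (N : Set (E p)) : Prop :=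
  ∀ (j k : Fin p) (l : Fin r),
    (∀ θ ∈ N, LineDifferentiableAt ℝ (partialDeriv k (fun θ' => m θ' l)) θ
      (EuclideanSpace.single j 1)) ∧
    ∃ C : ℝ, ∀ θ ∈ N, |partialDeriv j (partialDeriv k (fun θ' => m θ' l)) θ| ≤ C

/-- `θ` is a root of the restricted estimating equation for the sample `x₁, …, x_n`: it satisfies
the restrictions `m(θ) = 0` and, for a vector `lam` of Lagrange multipliers,
`n⁻¹ ∑ ψ(x_i, θ) + M(θ) lam = 0`. -/
def IsRestrictedRoot {𝒳 : Type*} [MeasurableSpace 𝒳] (𝓕 : Model p 𝒳) (B : ℝ → ℝ)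
    (m : E p → Fin r → ℝ) {n : ℕ} (x : Fin n → 𝒳) (θ : E p) : Prop :=
  θ ∈ 𝓕.Θ ∧ m θ = 0 ∧
    ∃ lam : Fin r → ℝ,
      (fun k => (n : ℝ)⁻¹ * ∑ i, 𝓕.psi B (x i) θ k) + (constraintMatrix m θ).mulVec lam = 0

/-- `est` is a consistent sequence of roots of the restricted estimating equation for the data
`X₀, X₁, …`: `est n` is a root for the first `n` observations with probability tending to one, and
`est n` converges to `θ₀` in probability. -/
def IsConsistentRootSeq {𝒳 Ω : Type*} [MeasurableSpace 𝒳] [MeasurableSpace Ω] (P : Measure Ω)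
    (𝓕 : Model p 𝒳) (B : ℝ → ℝ) (m : E p → Fin r → ℝ) (X : ℕ → Ω → 𝒳) (θ₀ : E p)
    (est : ℕ → Ω → E p) : Prop :=
  Tendsto (fun n => P {ω | ¬ IsRestrictedRoot 𝓕 B m (fun i : Fin n => X i ω) (est n ω)})
    atTop (𝓝 0) ∧
  TendstoInMeasure P est atTop (fun _ => θ₀)

/-- `Q = J⁻¹ M (Mᵀ J⁻¹ M)⁻¹`. -/
def Qmat (J : Matrix (Fin p) (Fin p) ℝ) (M : Matrix (Fin p) (Fin r) ℝ) :
    Matrix (Fin p) (Fin r) ℝ :=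
  J⁻¹ * M * (M.transpose * J⁻¹ * M)⁻¹

/-- `P = J⁻¹ - Q Mᵀ J⁻¹`. -/
def Pmat (J : Matrix (Fin p) (Fin p) ℝ) (M : Matrix (Fin p) (Fin r) ℝ) :
    Matrix (Fin p) (Fin p) ℝ :=
  J⁻¹ - Qmat J M * M.transpose * J⁻¹

/-- `Σ = P K P`. -/
def Sigmamat (J K : Matrix (Fin p) (Fin p) ℝ) (M : Matrix (Fin p) (Fin r) ℝ) :
    Matrix (Fin p) (Fin p) ℝ :=
  Pmat J M * K * Pmat J M

end Bregman

end

/-! Adjoin the Lagrange multiplier and read the estimating equation as `F(θ, λ) = (s(θ) + M(θ)λ,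
m(θ)) = 0` (`estEq`), with `s` the averaged score. Since `ψ = -∇V`, the derivative of `s` at `θ₀` is
an average that tends to `-E_g[∇²V]` by the law of large numbers. As `g = f_θ₀`, this limit is `-J`,
and `J` is positive definite by (A4). The bound (A5) on third derivatives makes the linearization
uniform on a small ball: with probability tending to one, `F` differs there from an affine map with
linear part `A(θ, λ) = (-Jθ + Mλ, Mᵀθ)` by a map of small Lipschitz constant
(`exists_highProb_avgScore_approx`, `exists_estEq_approx`). Positive definiteness of `J` and full
rank of `M` make `A` invertible, and the upper left block of its inverse is `-P`
(`exists_linearization`).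

Existence: `F(θ₀, 0) = (s(θ₀), 0)` tends to zero in probability because `ψ` has mean zero at `θ₀`.
The iteration `z ↦ z - A⁻¹F(z)` is then a contraction of the ball and finds a root near `(θ₀, 0)`
(`exists_zero_tendsto_iterate`); as a limit of measurable iterates the root is measurable in the
sample (`exists_measurable_root`).

Normality: at a root close to `θ₀` the multiplier is small too, because `M(θ)λ = -s(θ)`. The
linearization therefore applies and gives `θ - θ₀ = P s(θ₀)` up to `c‖s(θ₀)‖`, for every `c > 0`
(`exists_root_expansion`). The central limit theorem for `√n s(θ₀)` and Slutsky's theorem give the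
limit `N(0, PKPᵀ)` (`tendstoInDistribution_of_expansion`), and `P` is symmetric. -/

noncomputable section

namespace Bregman

variable {p r : ℕ}

/-! ### Calculus on cubes from bounds on partial derivatives -/

/-- The open cube with centre `c` and half side `δ`. -/
def cube (c : E p) (δ : ℝ) : Set (E p) := {θ | ∀ k, |θ k - c k| < δ}

lemma center_mem_cube (c : E p) {δ : ℝ} (hδ : 0 < δ) : c ∈ cube c δ := fun k => by simpa using hδ

lemma cube_mono (c : E p) {δ δ' : ℝ} (h : δ ≤ δ') : cube c δ ⊆ cube c δ' :=
  fun _ hθ k => (hθ k).trans_le h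

lemma abs_apply_le_norm (θ : E p) (k : Fin p) : |θ k| ≤ ‖θ‖ := by
  simpa using PiLp.norm_apply_le θ k

lemma ball_subset_cube (c : E p) (δ : ℝ) : Metric.ball c δ ⊆ cube c δ := by
  intro θ hθ k
  have := abs_apply_le_norm (θ - c) k
  rw [Metric.mem_ball, dist_eq_norm] at hθ
  exact (by simpa using this : |θ k - c k| ≤ _).trans_lt hθ

lemma eq_sum_smul_single (v : E p) : v = ∑ j, v j • EuclideanSpace.single j (1 : ℝ) := by
  ext k
  simp [Finset.sum_apply, Pi.single_apply]

lemma norm_le_sum_abs (θ : E p) : ‖θ‖ ≤ ∑ k, |θ k| := by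
  have h := eq_sum_smul_single θ
  calc ‖θ‖ = ‖∑ k, θ k • EuclideanSpace.single k (1 : ℝ)‖ := by rw [← h]
    _ ≤ ∑ k, ‖θ k • EuclideanSpace.single k (1 : ℝ)‖ := norm_sum_le _ _
    _ = ∑ k, |θ k| := by simp [norm_smul]

lemma sum_abs_le_norm (θ : E p) : ∑ k, |θ k| ≤ p * ‖θ‖ := by
  calc ∑ k, |θ k| ≤ ∑ _k : Fin p, ‖θ‖ := Finset.sum_le_sum fun k _ => abs_apply_le_norm θ k
    _ = p * ‖θ‖ := by simp

lemma exists_cube_subset {N : Set (E p)} (hN : IsOpen N) {c : E p} (hc : c ∈ N) :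
    ∃ δ > 0, cube c δ ⊆ N := by
  obtain ⟨ε, hε, h⟩ := Metric.isOpen_iff.1 hN c hc
  -- The `+ 1` makes the final inequality strict and covers `p = 0`.
  refine ⟨ε / (p + 1), by positivity, fun θ hθ => h ?_⟩
  rw [Metric.mem_ball, dist_eq_norm]
  have hp : (0 : ℝ) < p + 1 := by positivity
  calc ‖θ - c‖ ≤ ∑ k, |(θ - c) k| := norm_le_sum_abs _
    _ ≤ ∑ _k : Fin p, ε / (p + 1) := Finset.sum_le_sum fun k _ => by simpa using (hθ k).le
    _ = p * (ε / (p + 1)) := by simp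
    _ < ε := by
      rw [mul_div_assoc', div_lt_iff₀ hp]
      nlinarith

lemma hasDerivAt_line {h : E p → ℝ} {θ e : E p} {t : ℝ}
    (hd : LineDifferentiableAt ℝ h (θ + t • e) e) :
    HasDerivAt (fun s => h (θ + s • e)) (lineDeriv ℝ h (θ + t • e) e) t := by
  have h0 : HasDerivAt (fun s => h (θ + t • e + s • e)) (lineDeriv ℝ h (θ + t • e) e) (t - t) := by
    rw [sub_self]; exact hd.hasLineDerivAt
  have := h0.comp_sub_const t t
  refine this.congr_of_eventuallyEq (Eventually.of_forall fun s => ?_)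
  simp only
  congr 1
  module

lemma add_smul_single_apply (θ : E p) (t : ℝ) (k j : Fin p) :
    (θ + t • EuclideanSpace.single k (1 : ℝ)) j = if j = k then θ j + t else θ j := by
  by_cases hjk : j = k <;> simp [hjk]

/-- A function whose partial derivatives are bounded on a cube is Lipschitz on it. -/
lemma abs_sub_le_of_partialDeriv_le {h : E p → ℝ} {c : E p} {δ C : ℝ}
    (hd : ∀ k, ∀ θ ∈ cube c δ, LineDifferentiableAt ℝ h θ (EuclideanSpace.single k 1))
    (hb : ∀ k, ∀ θ ∈ cube c δ, |partialDeriv k h θ| ≤ C)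
    {θ₁ θ₂ : E p} (h₁ : θ₁ ∈ cube c δ) (h₂ : θ₂ ∈ cube c δ) :
    |h θ₁ - h θ₂| ≤ C * ∑ k, |θ₁ k - θ₂ k| := by
  -- Change one coordinate at a time, `S` being the set of coordinates in which the points may
  -- differ. A cube contains each of these axis-parallel segments, so the one-variable mean value
  -- inequality applies without joint differentiability.
  suffices H : ∀ S : Finset (Fin p), ∀ θ₂ ∈ cube c δ, (∀ k ∉ S, θ₁ k = θ₂ k) →
      |h θ₁ - h θ₂| ≤ C * ∑ k ∈ S, |θ₁ k - θ₂ k| from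
    H Finset.univ θ₂ h₂ (by simp)
  intro S
  induction S using Finset.induction_on with
  | empty =>
    intro θ₂ _ he
    have : θ₁ = θ₂ := by ext k; exact he k (by simp)
    simp [this]
  | insert k S hk ih =>
    intro θ₂ h₂ he
    set τ := θ₁ k - θ₂ k with hτ
    set θ' := θ₂ + τ • EuclideanSpace.single k (1 : ℝ) with hθ'
    have hline : ∀ t ∈ Set.uIcc 0 τ, θ₂ + t • EuclideanSpace.single k (1 : ℝ) ∈ cube c δ := by
      intro t ht j
      rw [add_smul_single_apply]
      split_ifs with hj
      · subst hj
        have a1 := abs_lt.1 (h₁ j)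
        have a2 := abs_lt.1 (h₂ j)
        rcases Set.mem_uIcc.1 ht with ⟨b1, b2⟩ | ⟨b1, b2⟩ <;>
          exact abs_lt.2 ⟨by linarith, by linarith⟩
      · exact h₂ j
    have hstep : |h θ' - h θ₂| ≤ C * |τ| := by
      have := Convex.norm_image_sub_le_of_norm_hasDerivWithin_le
        (f := fun s => h (θ₂ + s • EuclideanSpace.single k (1 : ℝ)))
        (f' := fun s => partialDeriv k h (θ₂ + s • EuclideanSpace.single k (1 : ℝ)))
        (s := Set.uIcc 0 τ) (x := 0) (y := τ) (C := C)
        (fun t ht => (hasDerivAt_line (hd k _ (hline t ht))).hasDerivWithinAt)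
        (fun t ht => hb k _ (hline t ht)) (convex_uIcc 0 τ) (by simp) (by simp)
      simpa [hθ'] using this
    have hθ'mem : θ' ∈ cube c δ := hline τ (by simp)
    have hθ'j : ∀ j, θ' j = if j = k then θ₂ j + τ else θ₂ j := add_smul_single_apply θ₂ τ k
    have hrest := ih θ' hθ'mem (by
      intro j hj
      rw [hθ'j]
      split_ifs with hjk
      · subst hjk; simp [hτ]
      · exact he j (by simp [hjk, hj]))
    have hsum : ∑ j ∈ S, |θ₁ j - θ' j| = ∑ j ∈ S, |θ₁ j - θ₂ j| := by
      refine Finset.sum_congr rfl fun j hj => ?_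
      rw [hθ'j, if_neg (by rintro rfl; exact hk hj)]
    rw [Finset.sum_insert hk, mul_add, ← hsum]
    calc |h θ₁ - h θ₂| ≤ |h θ₁ - h θ'| + |h θ' - h θ₂| := abs_sub_le _ _ _
      _ ≤ _ := by linarith

lemma hasLineDerivAt_sum_mul (a : Fin p → ℝ) (θ : E p) (k : Fin p) :
    HasLineDerivAt ℝ (fun θ : E p => ∑ j, a j * θ j) (a k) θ (EuclideanSpace.single k 1) := by
  have : (fun t : ℝ => ∑ j, a j * (θ + t • EuclideanSpace.single k (1 : ℝ)) j)
      = fun t => ∑ j, a j * θ j + a k * t := by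
    funext t
    simp_rw [add_smul_single_apply]
    rw [← sub_eq_iff_eq_add', ← Finset.sum_sub_distrib, Finset.sum_eq_single k]
    · simp; ring
    · intro j _ hj; simp [hj]
    · simp
  unfold HasLineDerivAt
  rw [this]
  simpa using ((hasDerivAt_id (0 : ℝ)).const_mul (a k)).const_add (∑ j, a j * θ j)

/-- First order expansion on a cube of a function with bounded second partial derivatives. -/
lemma abs_sub_sub_le_of_partialDeriv_partialDeriv_le {h : E p → ℝ} {c : E p} {δ C : ℝ} (hδ : 0 < δ)
    (hC : 0 ≤ C)
    (hd : ∀ k, ∀ θ ∈ cube c δ, LineDifferentiableAt ℝ h θ (EuclideanSpace.single k 1))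
    (hd2 : ∀ j k, ∀ θ ∈ cube c δ,
      LineDifferentiableAt ℝ (partialDeriv k h) θ (EuclideanSpace.single j 1))
    (hb : ∀ j k, ∀ θ ∈ cube c δ, |partialDeriv j (partialDeriv k h) θ| ≤ C)
    {θ₁ θ₂ : E p} (h₁ : θ₁ ∈ cube c δ) (h₂ : θ₂ ∈ cube c δ) :
    |h θ₁ - h θ₂ - ∑ k, partialDeriv k h c * (θ₁ k - θ₂ k)|
      ≤ C * (p * δ) * ∑ k, |θ₁ k - θ₂ k| := by
  set a : Fin p → ℝ := fun k => partialDeriv k h c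
  have hlin : ∀ k, ∀ θ ∈ cube c δ, HasLineDerivAt ℝ (fun θ : E p => h θ - ∑ j, a j * θ j)
      (partialDeriv k h θ - a k) θ (EuclideanSpace.single k 1) := fun k θ hθ =>
    HasDerivAt.sub (hd k θ hθ).hasLineDerivAt (hasLineDerivAt_sum_mul a θ k)
  -- Subtract the linear part at `c`. The partial derivatives of the difference vanish at `c` and
  -- are Lipschitz, hence at most `C * (p * δ)` on the cube.
  have := abs_sub_le_of_partialDeriv_le (h := fun θ : E p => h θ - ∑ j, a j * θ j) (c := c) (δ := δ)
    (C := C * (p * δ)) (fun k θ hθ => (hlin k θ hθ).lineDifferentiableAt) (fun k θ hθ => by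
      rw [partialDeriv, (hlin k θ hθ).lineDeriv]
      refine (abs_sub_le_of_partialDeriv_le (fun j => hd2 j k) (fun j => hb j k) hθ
        (center_mem_cube c hδ)).trans (mul_le_mul_of_nonneg_left ?_ hC)
      calc ∑ j, |θ j - c j| ≤ ∑ _j : Fin p, δ := Finset.sum_le_sum fun j _ => (hθ j).le
        _ = p * δ := by simp) h₁ h₂
  refine le_trans (le_of_eq ?_) this
  congr 1
  simp only [mul_sub, Finset.sum_sub_distrib, a]
  ring

/-! ### Maps close to an affine isomorphism -/

section Newton

variable {Z Y : Type*} [NormedAddCommGroup Z] [NormedSpace ℝ Z] [NormedAddCommGroup Y]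
  [NormedSpace ℝ Y]

/-- A zero of a map that is close to an affine isomorphism is close to the zero of the latter. -/
lemma norm_sub_le_of_zero {F : Z → Y} {A : Z ≃L[ℝ] Y} {z₀ z : Z} {c : ℝ}
    (hc : 0 ≤ c) (hA : ‖(A.symm : Y →L[ℝ] Z)‖ * c ≤ 1 / 2)
    (happ : ‖F z - F z₀ - A (z - z₀)‖ ≤ c * ‖z - z₀‖) (hz : F z = 0) :
    ‖z - z₀‖ ≤ 2 * ‖A.symm (F z₀)‖ ∧
      ‖z - z₀ + A.symm (F z₀)‖ ≤ ‖(A.symm : Y →L[ℝ] Z)‖ * c * (2 * ‖A.symm (F z₀)‖) := by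
  have h1 : z - z₀ + A.symm (F z₀) = -(A.symm (F z - F z₀ - A (z - z₀))) := by
    simp [hz, map_sub]
  have h2 : ‖z - z₀ + A.symm (F z₀)‖ ≤ ‖(A.symm : Y →L[ℝ] Z)‖ * c * ‖z - z₀‖ := by
    rw [h1, norm_neg, mul_assoc]
    exact ((A.symm : Y →L[ℝ] Z).le_opNorm _).trans
      (mul_le_mul_of_nonneg_left happ (norm_nonneg _))
  have h3 : ‖z - z₀‖ ≤ ‖z - z₀ + A.symm (F z₀)‖ + ‖A.symm (F z₀)‖ := by
    simpa using norm_sub_le (z - z₀ + A.symm (F z₀)) (A.symm (F z₀))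
  have h4 : ‖(A.symm : Y →L[ℝ] Z)‖ * c * ‖z - z₀‖ ≤ 1 / 2 * ‖z - z₀‖ :=
    mul_le_mul_of_nonneg_right hA (norm_nonneg _)
  have h5 : ‖z - z₀‖ ≤ 2 * ‖A.symm (F z₀)‖ := by linarith
  exact ⟨h5, h2.trans (mul_le_mul_of_nonneg_left h5 (by positivity))⟩

/-- Simplified Newton iteration: a map that is close to an affine isomorphism on a ball, and small at
its centre, has a zero in the ball, to which the iteration converges. -/
lemma exists_zero_tendsto_iterate [CompleteSpace Z] {F : Z → Y} {A : Z ≃L[ℝ] Y} {z₀ : Z} {c δ : ℝ}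
    (hδ : 0 ≤ δ) (hA : ‖(A.symm : Y →L[ℝ] Z)‖ * c ≤ 1 / 2)
    (happ : ∀ z₁ ∈ Metric.closedBall z₀ δ, ∀ z₂ ∈ Metric.closedBall z₀ δ,
      ‖F z₁ - F z₂ - A (z₁ - z₂)‖ ≤ c * ‖z₁ - z₂‖)
    (hsmall : 2 * ‖A.symm (F z₀)‖ ≤ δ) {g : Z → Z}
    (hg : ∀ z ∈ Metric.closedBall z₀ δ, g z = z - A.symm (F z)) :
    ∃ z ∈ Metric.closedBall z₀ δ, F z = 0 ∧ Tendsto (fun k => g^[k] z₀) atTop (𝓝 z) := by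
  have hlip : ∀ z₁ ∈ Metric.closedBall z₀ δ, ∀ z₂ ∈ Metric.closedBall z₀ δ,
      ‖g z₁ - g z₂‖ ≤ 1 / 2 * ‖z₁ - z₂‖ := by
    intro z₁ h₁ z₂ h₂
    have : g z₁ - g z₂ = -(A.symm (F z₁ - F z₂ - A (z₁ - z₂))) := by
      rw [hg _ h₁, hg _ h₂]
      simp only [map_sub, A.symm_apply_apply]
      abel
    rw [this, norm_neg]
    calc _ ≤ ‖(A.symm : Y →L[ℝ] Z)‖ * ‖F z₁ - F z₂ - A (z₁ - z₂)‖ :=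
          (A.symm : Y →L[ℝ] Z).le_opNorm _
      _ ≤ ‖(A.symm : Y →L[ℝ] Z)‖ * (c * ‖z₁ - z₂‖) :=
          mul_le_mul_of_nonneg_left (happ _ h₁ _ h₂) (norm_nonneg _)
      _ = (‖(A.symm : Y →L[ℝ] Z)‖ * c) * ‖z₁ - z₂‖ := by ring
      _ ≤ _ := mul_le_mul_of_nonneg_right hA (norm_nonneg _)
  have hz₀ : z₀ ∈ Metric.closedBall z₀ δ := Metric.mem_closedBall_self hδ
  have hmaps : Set.MapsTo g (Metric.closedBall z₀ δ) (Metric.closedBall z₀ δ) := by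
    intro z hz
    rw [mem_closedBall_iff_norm] at hz ⊢
    have h1 := hlip z (mem_closedBall_iff_norm.2 hz) z₀ hz₀
    -- The centre moves by at most `δ / 2`, and the contraction adds at most another `δ / 2`, so the
    -- ball is mapped into itself.
    have h2 : ‖g z₀ - z₀‖ = ‖A.symm (F z₀)‖ := by rw [hg _ hz₀]; simp
    have h3 := norm_add_le (g z - g z₀) (g z₀ - z₀)
    rw [sub_add_sub_cancel] at h3
    linarith
  have hcontr : ContractingWith (1 / 2) (hmaps.restrict g _ _) := by
    refine ⟨by rw [← NNReal.coe_lt_coe]; norm_num, LipschitzWith.of_dist_le_mul fun x y => ?_⟩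
    simpa [dist_eq_norm, Subtype.dist_eq] using hlip x x.2 y y.2
  obtain ⟨y, hy, hfix, htend, -⟩ := hcontr.exists_fixedPoint' Metric.isClosed_closedBall.isComplete
    hmaps hz₀ (edist_ne_top _ _)
  refine ⟨y, hy, ?_, htend⟩
  have : y - A.symm (F y) = y := by rw [← hg y hy]; exact hfix
  simpa using this

end Newton

lemma norm_mulVec_le {b : ℝ} (hb : 0 ≤ b) {B : Matrix (Fin p) (Fin r) ℝ} (h : ∀ j l, |B j l| ≤ b)
    (v : Fin r → ℝ) : ‖B.mulVec v‖ ≤ r * b * ‖v‖ := by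
  refine (pi_norm_le_iff_of_nonneg (by positivity)).2 fun j => ?_
  calc ‖B.mulVec v j‖ = |∑ l, B j l * v l| := rfl
    _ ≤ ∑ l, |B j l * v l| := Finset.abs_sum_le_sum_abs _ _
    _ ≤ ∑ _l : Fin r, b * ‖v‖ := Finset.sum_le_sum fun l _ => by
        rw [abs_mul]
        exact mul_le_mul (h j l) (norm_le_pi_norm v l) (abs_nonneg _) hb
    _ = r * b * ‖v‖ := by simp; ring

lemma mulVec_injective_of_rank_eq {M : Matrix (Fin p) (Fin r) ℝ} (h : M.rank = r) :
    Function.Injective M.mulVec := by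
  rw [Matrix.mulVec_injective_iff, linearIndependent_iff_card_eq_finrank_span, Set.finrank,
    ← Matrix.rank_eq_finrank_span_cols, h, Fintype.card_fin]

/-! ### The linearized equations -/

section LinearAlgebra

variable {J : Matrix (Fin p) (Fin p) ℝ} {M : Matrix (Fin p) (Fin r) ℝ}

/-- Injectivity of `M` carries positive definiteness over from `J⁻¹` to `MᵀJ⁻¹M`. -/
lemma isUnit_det_transpose_mul_inv_mul (hJ : J.PosDef) (hM : M.rank = r) :
    IsUnit (M.transpose * J⁻¹ * M).det := by
  have := (hJ.inv).conjTranspose_mul_mul_same (mulVec_injective_of_rank_eq hM)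
  rw [Matrix.conjTranspose_eq_transpose_of_trivial] at this
  exact (Matrix.isUnit_iff_isUnit_det _).1 this.isUnit

/-- This turns the covariance `PKPᵀ`, as it arises from a linear image, into the stated `PKP`. -/
lemma Pmat_transpose (hJ : J.PosDef) : (Pmat J M).transpose = Pmat J M := by
  have hJt : J.transpose = J := by
    simpa [Matrix.conjTranspose_eq_transpose_of_trivial] using hJ.isHermitian.eq
  simp only [Pmat, Qmat, Matrix.transpose_sub, Matrix.transpose_mul, Matrix.transpose_nonsing_inv,
    hJt, Matrix.transpose_transpose, Matrix.mul_assoc]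

/-- The linearized estimating equations `(θ, λ) ↦ (-Jθ + Mλ, Mᵀθ)` form an isomorphism, whose
inverse maps `(v, 0)` to a vector with first component `-Pv`. -/
lemma exists_linearization (hJ : J.PosDef) (hM : M.rank = r) :
    ∃ A : (E p × (Fin r → ℝ)) ≃L[ℝ] ((Fin p → ℝ) × (Fin r → ℝ)),
      (∀ z, A z = (-J.mulVec z.1.ofLp + M.mulVec z.2, M.transpose.mulVec z.1.ofLp)) ∧
      ∀ v, (A.symm (v, 0)).1 = -WithLp.toLp 2 ((Pmat J M).mulVec v) := by
  have hdJ : IsUnit J.det := (Matrix.isUnit_iff_isUnit_det _).1 hJ.isUnit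
  have hdS := isUnit_det_transpose_mul_inv_mul hJ hM
  set S := (M.transpose * J⁻¹ * M)⁻¹ with hS
  have hS1 : S * (M.transpose * J⁻¹ * M) = 1 := Matrix.nonsing_inv_mul _ hdS
  have hS2 : (M.transpose * J⁻¹ * M) * S = 1 := Matrix.mul_nonsing_inv _ hdS
  have hJ1 : J⁻¹ * J = 1 := Matrix.nonsing_inv_mul _ hdJ
  have hJ2 : J * J⁻¹ = 1 := Matrix.mul_nonsing_inv _ hdJ
  set Q := Qmat J M with hQ
  set T := Pmat J M with hT
  set R := S * M.transpose * J⁻¹ with hR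
  have hQ' : Q = J⁻¹ * M * S := rfl
  have hT' : T = J⁻¹ - Q * M.transpose * J⁻¹ := rfl
  -- The block matrix `[-J, M; Mᵀ, 0]` has inverse `[-T, Q; R, S]`. The identities `e1` to `e8`
  -- provide the entries of the two products.
  have e1 : T * J + Q * M.transpose = 1 := by
    rw [hT', Matrix.sub_mul, Matrix.mul_assoc, Matrix.mul_assoc, hJ1, Matrix.mul_one,
      sub_add_cancel]
  have e2 : T * M = 0 := by
    have : Q * M.transpose * J⁻¹ * M = J⁻¹ * M * (S * (M.transpose * J⁻¹ * M)) := by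
      rw [hQ']; simp only [Matrix.mul_assoc]
    rw [hT', Matrix.sub_mul, this, hS1, Matrix.mul_one, sub_self]
  have e3 : R * J = S * M.transpose := by rw [hR, Matrix.mul_assoc, hJ1, Matrix.mul_one]
  have e4 : R * M = 1 := by rw [← hS1, hR]; simp only [Matrix.mul_assoc]
  have e5 : J * Q = M * S := by rw [hQ', ← Matrix.mul_assoc, ← Matrix.mul_assoc, hJ2, Matrix.one_mul]
  have e6 : J * T + M * R = 1 := by
    have : J * (Q * M.transpose * J⁻¹) = M * R := by
      rw [hR, Matrix.mul_assoc Q, ← Matrix.mul_assoc J, e5]; simp only [Matrix.mul_assoc]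
    rw [hT', Matrix.mul_sub, hJ2, this, sub_add_cancel]
  have e7 : M.transpose * Q = 1 := by rw [← hS2, hQ']; simp only [Matrix.mul_assoc]
  have e8 : M.transpose * T = 0 := by
    rw [hT', Matrix.mul_sub, Matrix.mul_assoc Q, ← Matrix.mul_assoc M.transpose, e7, Matrix.one_mul,
      sub_self]
  let L : (E p × (Fin r → ℝ)) ≃ₗ[ℝ] ((Fin p → ℝ) × (Fin r → ℝ)) :=
    { toFun := fun z => (-J.mulVec z.1.ofLp + M.mulVec z.2, M.transpose.mulVec z.1.ofLp)
      invFun := fun w => (WithLp.toLp 2 (-T.mulVec w.1 + Q.mulVec w.2), R.mulVec w.1 + S.mulVec w.2)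
      map_add' := fun z w => by
        ext <;> simp [Matrix.mulVec_add]; ring
      map_smul' := fun a z => by
        ext <;> simp [Matrix.mulVec_smul]
      left_inv := fun z => by
        refine Prod.ext (WithLp.ofLp_injective 2 ?_) ?_
        · simp only [Matrix.mulVec_add, Matrix.mulVec_neg, Matrix.mulVec_mulVec, e2, neg_neg,
            Matrix.zero_mulVec, add_zero]
          rw [← Matrix.add_mulVec, e1, Matrix.one_mulVec]
        · simp only [Matrix.mulVec_add, Matrix.mulVec_neg, Matrix.mulVec_mulVec, e3, e4,
            Matrix.one_mulVec]
          abel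
      right_inv := fun w => by
        refine Prod.ext ?_ ?_
        · simp only [Matrix.mulVec_add, Matrix.mulVec_neg, Matrix.mulVec_mulVec, e5]
          have : w.1 = (J * T).mulVec w.1 + (M * R).mulVec w.1 := by
            rw [← Matrix.add_mulVec, e6, Matrix.one_mulVec]
          conv_rhs => rw [this]
          abel
        · simp only [Matrix.mulVec_add, Matrix.mulVec_neg, Matrix.mulVec_mulVec, e7, e8,
            Matrix.one_mulVec, Matrix.zero_mulVec, neg_zero, zero_add] }
  refine ⟨L.toContinuousLinearEquiv, fun z => rfl, fun v => ?_⟩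
  change WithLp.toLp 2 (-T.mulVec v + Q.mulVec 0) = _
  simp

end LinearAlgebra

/-! ### Near linearity of the restricted equations -/

/-- The restricted estimating equations in the parameter and the multipliers. -/
def estEq (s : E p → Fin p → ℝ) (Mf : E p → Matrix (Fin p) (Fin r) ℝ) (m : E p → Fin r → ℝ)
    (z : E p × (Fin r → ℝ)) : (Fin p → ℝ) × (Fin r → ℝ) :=
  (s z.1 + (Mf z.1).mulVec z.2, m z.1)

/-- If the averaged score is nearly linear around `θ₀`, so are the restricted estimating
equations. -/
lemma exists_estEq_approx {J : Matrix (Fin p) (Fin p) ℝ} {Mf : E p → Matrix (Fin p) (Fin r) ℝ}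
    {m : E p → Fin r → ℝ} {θ₀ : E p} {L ρ : ℝ} (hρ : 0 < ρ) (hL : 0 ≤ L)
    (hMf : ∀ θ₁ ∈ Metric.closedBall θ₀ ρ, ∀ θ₂ ∈ Metric.closedBall θ₀ ρ, ∀ j l,
      |Mf θ₁ j l - Mf θ₂ j l| ≤ L * ‖θ₁ - θ₂‖)
    (hm : ∀ c > 0, ∃ δ > 0, ∀ θ₁ ∈ Metric.closedBall θ₀ δ, ∀ θ₂ ∈ Metric.closedBall θ₀ δ,
      ‖m θ₁ - m θ₂ - (Mf θ₀).transpose.mulVec (θ₁ - θ₂).ofLp‖ ≤ c * ‖θ₁ - θ₂‖)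
    {A : (E p × (Fin r → ℝ)) ≃L[ℝ] ((Fin p → ℝ) × (Fin r → ℝ))}
    (hA : ∀ z, A z = (-J.mulVec z.1.ofLp + (Mf θ₀).mulVec z.2,
      (Mf θ₀).transpose.mulVec z.1.ofLp))
    {c : ℝ} (hc : 0 < c) :
    ∃ δ₁ > 0, ∀ δ ≤ δ₁, ∀ s : E p → Fin p → ℝ,
      (∀ θ₁ ∈ Metric.closedBall θ₀ δ, ∀ θ₂ ∈ Metric.closedBall θ₀ δ,
        ‖s θ₁ - s θ₂ + J.mulVec (θ₁ - θ₂).ofLp‖ ≤ c / 2 * ‖θ₁ - θ₂‖) →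
      ∀ z₁ ∈ Metric.closedBall (θ₀, (0 : Fin r → ℝ)) δ,
      ∀ z₂ ∈ Metric.closedBall (θ₀, (0 : Fin r → ℝ)) δ,
        ‖estEq s Mf m z₁ - estEq s Mf m z₂ - A (z₁ - z₂)‖ ≤ c * ‖z₁ - z₂‖ := by
  obtain ⟨δm, hδm, hm'⟩ := hm c hc
  -- The last bound gives `r * L * δ ≤ c / 4`. In the first component the score then uses `c / 2`
  -- and each of the two multiplier terms `c / 4`.
  refine ⟨min (min ρ δm) (c / (4 * (r * L + 1))), by positivity, ?_⟩
  intro δ hδ s hs z₁ hz₁ z₂ hz₂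
  have hδρ : δ ≤ ρ := hδ.trans ((min_le_left _ _).trans (min_le_left _ _))
  have hδδm : δ ≤ δm := hδ.trans ((min_le_left _ _).trans (min_le_right _ _))
  have hδc : r * L * δ ≤ c / 4 := by
    have h1 : δ ≤ c / (4 * (r * L + 1)) := hδ.trans (min_le_right _ _)
    have h2 : r * L * δ ≤ r * L * (c / (4 * (r * L + 1))) :=
      mul_le_mul_of_nonneg_left h1 (by positivity)
    refine h2.trans ?_
    rw [mul_div_assoc', div_le_div_iff₀ (by positivity) (by positivity)]
    nlinarith [mul_nonneg (Nat.cast_nonneg (α := ℝ) r) hL]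
  rw [← closedBall_prod_same] at hz₁ hz₂
  obtain ⟨θ₁, l₁⟩ := z₁
  obtain ⟨θ₂, l₂⟩ := z₂
  obtain ⟨hθ₁, hl₁⟩ := hz₁
  obtain ⟨hθ₂, hl₂⟩ := hz₂
  simp only at hθ₁ hθ₂ hl₁ hl₂
  have hδ0 : 0 ≤ δ := dist_nonneg.trans (Metric.mem_closedBall.1 hθ₁)
  have hsub : Metric.closedBall θ₀ δ ⊆ Metric.closedBall θ₀ ρ := Metric.closedBall_subset_closedBall hδρ
  have hθn : ‖θ₁ - θ₂‖ ≤ ‖(θ₁, l₁) - (θ₂, l₂)‖ := le_max_left _ _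
  have hln : ‖l₁ - l₂‖ ≤ ‖(θ₁, l₁) - (θ₂, l₂)‖ := le_max_right _ _
  set Δ := ‖(θ₁, l₁) - (θ₂, l₂)‖
  have hθ₁d : ‖θ₁ - θ₀‖ ≤ δ := by simpa [dist_eq_norm] using hθ₁
  have hl₂d : ‖l₂‖ ≤ δ := by simpa using hl₂
  have b1 : ‖(Mf θ₁ - Mf θ₀).mulVec (l₁ - l₂)‖ ≤ c / 4 * Δ := by
    refine (norm_mulVec_le (b := L * δ) (by positivity) (fun j l => ?_) _).trans ?_
    · exact (hMf θ₁ (hsub hθ₁) θ₀ (Metric.mem_closedBall_self hρ.le) j l).trans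
        (mul_le_mul_of_nonneg_left hθ₁d hL)
    · rw [← mul_assoc]
      exact mul_le_mul hδc hln (norm_nonneg _) (by positivity)
  have b2 : ‖(Mf θ₁ - Mf θ₂).mulVec l₂‖ ≤ c / 4 * Δ := by
    refine (norm_mulVec_le (b := L * ‖θ₁ - θ₂‖) (by positivity)
      (fun j l => hMf θ₁ (hsub hθ₁) θ₂ (hsub hθ₂) j l) _).trans ?_
    calc r * (L * ‖θ₁ - θ₂‖) * ‖l₂‖ = (r * L * ‖l₂‖) * ‖θ₁ - θ₂‖ := by ring
      _ ≤ (c / 4) * Δ := mul_le_mul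
        ((mul_le_mul_of_nonneg_left hl₂d (by positivity)).trans hδc) hθn (norm_nonneg _)
        (by positivity)
  have b3 := hs θ₁ hθ₁ θ₂ hθ₂
  have b3' : ‖s θ₁ - s θ₂ + J.mulVec (θ₁ - θ₂).ofLp‖ ≤ c / 2 * Δ :=
    b3.trans (mul_le_mul_of_nonneg_left hθn (by positivity))
  have b4 : ‖m θ₁ - m θ₂ - (Mf θ₀).transpose.mulVec (θ₁ - θ₂).ofLp‖ ≤ c * Δ :=
    (hm' θ₁ (Metric.closedBall_subset_closedBall hδδm hθ₁) θ₂
      (Metric.closedBall_subset_closedBall hδδm hθ₂)).trans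
      (mul_le_mul_of_nonneg_left hθn hc.le)
  -- The bilinear term is split as `M₁l₁ - M₂l₂ - M₀(l₁ - l₂) = (M₁ - M₀)(l₁ - l₂) + (M₁ - M₂)l₂`,
  -- where each summand has one factor of order `δ`.
  have e : estEq s Mf m (θ₁, l₁) - estEq s Mf m (θ₂, l₂) - A ((θ₁, l₁) - (θ₂, l₂)) =
      ((s θ₁ - s θ₂ + J.mulVec (θ₁ - θ₂).ofLp) + ((Mf θ₁ - Mf θ₀).mulVec (l₁ - l₂)
        + (Mf θ₁ - Mf θ₂).mulVec l₂),
        m θ₁ - m θ₂ - (Mf θ₀).transpose.mulVec (θ₁ - θ₂).ofLp) := by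
    rw [hA]
    refine Prod.ext ?_ rfl
    simp only [estEq, Prod.mk_sub_mk, Matrix.sub_mulVec,
      Matrix.mulVec_sub]
    abel
  rw [e]
  refine max_le ?_ b4
  calc _ ≤ ‖s θ₁ - s θ₂ + J.mulVec (θ₁ - θ₂).ofLp‖ + (‖(Mf θ₁ - Mf θ₀).mulVec (l₁ - l₂)‖
        + ‖(Mf θ₁ - Mf θ₂).mulVec l₂‖) :=
        (norm_add_le _ _).trans (add_le_add le_rfl (norm_add_le _ _))
    _ ≤ c * Δ := by linarith

/-! ### Events of probability tending to one -/

section HighProb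

variable {Ω : Type*} [MeasurableSpace Ω] {P : Measure Ω}

/-- The events `A n` have probability tending to one. -/
def HighProb (P : Measure Ω) (A : ℕ → Ω → Prop) : Prop :=
  Tendsto (fun n => P {ω | ¬ A n ω}) atTop (𝓝 0)

/-- A single null set serves all `n`, so almost sure properties of the whole sample can be used.
Monotonicity of the outer measure suffices, and the events need not be measurable. -/
lemma HighProb.mono {A B : ℕ → Ω → Prop} (hA : HighProb P A)
    (h : ∀ᵐ ω ∂P, ∀ n, A n ω → B n ω) : HighProb P B := by
  refine tendsto_of_tendsto_of_tendsto_of_le_of_le tendsto_const_nhds hA (fun _ => zero_le) ?_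
  intro n
  refine measure_mono_ae ?_
  filter_upwards [h] with ω hω hB hA using hB (hω n hA)

lemma HighProb.and {A B : ℕ → Ω → Prop} (hA : HighProb P A) (hB : HighProb P B) :
    HighProb P (fun n ω => A n ω ∧ B n ω) := by
  have hAB : Tendsto (fun n => P {ω | ¬ A n ω} + P {ω | ¬ B n ω}) atTop (𝓝 0) := by
    simpa using Tendsto.add (f := fun n => P {ω | ¬ A n ω}) (g := fun n => P {ω | ¬ B n ω}) hA hB
  refine tendsto_of_tendsto_of_tendsto_of_le_of_le tendsto_const_nhds hAB (fun _ => zero_le) ?_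
  intro n
  refine (measure_mono fun ω hω => ?_).trans (measure_union_le _ _)
  by_contra h
  simp only [Set.mem_union, Set.mem_ofPred_eq, not_or, not_not] at h
  exact hω h

lemma HighProb.forall_fintype {ι : Type*} [Finite ι] {A : ι → ℕ → Ω → Prop}
    (h : ∀ i, HighProb P (A i)) : HighProb P (fun n ω => ∀ i, A i n ω) := by
  cases nonempty_fintype ι
  have hsum : Tendsto (fun n => ∑ i, P {ω | ¬ A i n ω}) atTop (𝓝 0) := by
    simpa using tendsto_finsetSum (Finset.univ : Finset ι) fun i _ => h i
  refine tendsto_of_tendsto_of_tendsto_of_le_of_le tendsto_const_nhds hsum (fun _ => zero_le) ?_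
  intro n
  refine (measure_mono (fun ω hω => ?_)).trans
    (measure_iUnion_fintype_le P fun i => {ω | ¬ A i n ω})
  simpa using hω

lemma tendstoInMeasure_iff_highProb {F : Type*} [SeminormedAddCommGroup F] {f : ℕ → Ω → F}
    {g : Ω → F} :
    TendstoInMeasure P f atTop g ↔ ∀ ε > 0, HighProb P (fun n ω => ‖f n ω - g ω‖ < ε) := by
  rw [tendstoInMeasure_iff_norm]
  simp [HighProb]

/-- Weak law of large numbers. -/
lemma highProb_average_sub_lt {𝒳 : Type*} [MeasurableSpace 𝒳] [IsProbabilityMeasure P]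
    {Q : Measure 𝒳} {X : ℕ → Ω → 𝒳} (hX : ∀ i, Measurable (X i)) (hindep : iIndepFun X P)
    (hlaw : ∀ i, P.map (X i) = Q) {f : 𝒳 → ℝ} (hf : Integrable f Q) {ε : ℝ} (hε : 0 < ε) :
    HighProb P (fun n ω => |(n : ℝ)⁻¹ * ∑ i : Fin n, f (X i ω) - ∫ x, f x ∂Q| < ε) := by
  -- Integrability gives measurability only up to a null set. The strong law is applied to a
  -- measurable version, with which `f` agrees almost surely along the whole sample.
  set f' := hf.1.mk f with hf'
  have hmeas : Measurable f' := hf.1.stronglyMeasurable_mk.measurable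
  have hae : f =ᵐ[Q] f' := hf.1.ae_eq_mk
  have hint' : Integrable f' Q := hf.congr hae
  have hident : ∀ i, IdentDistrib (X i) (X 0) P P := fun i =>
    ⟨(hX i).aemeasurable, (hX 0).aemeasurable, by rw [hlaw, hlaw]⟩
  have hint0 : Integrable (fun ω => f' (X 0 ω)) P := by
    have h := hint'
    rw [← hlaw 0] at h
    exact h.comp_measurable (hX 0)
  have hmean : ∫ ω, f' (X 0 ω) ∂P = ∫ x, f x ∂Q := by
    rw [integral_congr_ae hae, ← hlaw 0,
      integral_map (hX 0).aemeasurable hmeas.aestronglyMeasurable]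
  have hslln := strong_law_ae (fun i ω => f' (X i ω)) hint0
    (fun i j hij => (hindep.indepFun hij).comp hmeas hmeas)
    (fun i => (hident i).comp hmeas)
  have hTM := tendstoInMeasure_of_tendsto_ae (fun n => (Measurable.aestronglyMeasurable
    ((Finset.measurable_sum (Finset.range n) fun i _ => hmeas.comp (hX i)).const_smul
      ((n : ℝ)⁻¹)))) (by simpa using hslln)
  refine (tendstoInMeasure_iff_highProb.1 hTM ε hε).mono ?_
  have hX' : ∀ᵐ ω ∂P, ∀ i, f (X i ω) = f' (X i ω) :=
    ae_all_iff.2 fun i => ae_of_ae_map (hX i).aemeasurable (by rw [hlaw i]; exact hae)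
  filter_upwards [hX'] with ω hω n hn
  simp_rw [hω, ← hmean]
  rw [← Finset.sum_range (fun i => f' (X i ω))]
  simpa using hn

end HighProb

/-! ### Multivariate central limit theorem and Gaussian images -/

section CLT

variable {Ω : Type*} [MeasurableSpace Ω] {P : Measure Ω} [IsProbabilityMeasure P]

/-- Multivariate central limit theorem. -/
theorem tendstoInDistribution_inv_sqrt_smul_sum {ξ : ℕ → Ω → E p} {S : Matrix (Fin p) (Fin p) ℝ}
    (hS : S.PosSemidef) (hindep : iIndepFun ξ P) (hident : ∀ i, IdentDistrib (ξ i) (ξ 0) P P)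
    (hL2 : ∀ t : E p, MemLp (fun ω => inner ℝ (ξ 0 ω) t) 2 P)
    (hmean : ∀ t : E p, ∫ ω, inner ℝ (ξ 0 ω) t ∂P = 0)
    (hvar : ∀ t : E p, ∫ ω, (inner ℝ (ξ 0 ω) t) ^ 2 ∂P = t.ofLp ⬝ᵥ S.mulVec t.ofLp) :
    TendstoInDistribution (fun (n : ℕ) ω => (√(n : ℝ))⁻¹ • ∑ k ∈ Finset.range n, ξ k ω) atTop
      (id : E p → E p) (fun _ => P) (multivariateGaussian 0 S) := by
  have hm : ∀ i, AEMeasurable (ξ i) P := fun i => (hident i).aemeasurable_fst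
  have hmn : ∀ n : ℕ, AEMeasurable (fun ω => (√(n : ℝ))⁻¹ • ∑ k ∈ Finset.range n, ξ k ω) P :=
    fun n => (measurable_const_smul (√(n : ℝ))⁻¹).comp_aemeasurable
      (Finset.aemeasurable_fun_sum _ fun i _ => hm i)
  refine ⟨hmn, by fun_prop, ?_⟩
  refine ProbabilityMeasure.tendsto_iff_tendsto_charFun.2 fun t => ?_
  simp only [ProbabilityMeasure.coe_mk, Measure.map_id]
  have hinner : Measurable (fun x : E p => inner ℝ x t) := by fun_prop
  have hv : Var[fun ω => inner ℝ (ξ 0 ω) t; P] = t.ofLp ⬝ᵥ S.mulVec t.ofLp := by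
    exact (variance_of_integral_eq_zero (hinner.comp_aemeasurable (hm 0)) (hmean t)).trans (hvar t)
  have hclt := tendstoInDistribution_inv_sqrt_mul_sum_sub (P := P)
    (X := fun i ω => inner ℝ (ξ i ω) t) (Y := id)
    (P' := gaussianReal 0 Var[fun ω => inner ℝ (ξ 0 ω) t; P].toNNReal)
    ⟨by fun_prop, by simp⟩ (hL2 t) (hindep.comp (fun _ x => inner ℝ x t) (fun _ => hinner))
    (fun i => (hident i).comp hinner)
  -- Cramér–Wold: the characteristic function of the vector sum at `t` is that of its projection on
  -- `t` at `1`.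
  have hchar := ProbabilityMeasure.tendsto_iff_tendsto_charFun.1 hclt.tendsto 1
  simp only [ProbabilityMeasure.coe_mk, Measure.map_id, charFun_gaussianReal, hv, hmean t] at hchar
  have hnn : 0 ≤ t.ofLp ⬝ᵥ S.mulVec t.ofLp := by rw [← hv]; exact variance_nonneg _ _
  rw [charFun_multivariateGaussian hS]
  refine Tendsto.congr (fun n => ?_) (hchar.trans (le_of_eq ?_))
  · have hmn' : AEMeasurable (fun ω => (√(n : ℝ))⁻¹ *
        (∑ k ∈ Finset.range n, inner ℝ (ξ k ω) t - n * 0)) P :=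
      ((Finset.aemeasurable_fun_sum _ fun i _ => hinner.comp_aemeasurable (hm i)).sub
        aemeasurable_const).const_mul _
    rw [charFun_apply, charFun_apply, integral_map (hmn n) (by fun_prop),
      integral_map hmn' (by fun_prop)]
    refine integral_congr_ae (Eventually.of_forall fun ω => ?_)
    simp [real_inner_smul_left, sum_inner]
  · congr 2
    simp [hnn]

lemma multivariateGaussian_map_mulVec {K T : Matrix (Fin p) (Fin p) ℝ} (hK : K.PosSemidef) :
    (multivariateGaussian 0 K).map (fun x => WithLp.toLp 2 (T.mulVec x.ofLp)) =
      multivariateGaussian 0 (T * K * T.transpose) := by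
  have hS : (T * K * T.transpose).PosSemidef := by
    simpa [Matrix.conjTranspose_eq_transpose_of_trivial] using hK.mul_mul_conjTranspose_same T
  have hmeas : Measurable (fun x : E p => (WithLp.toLp 2 (T.mulVec x.ofLp) : E p)) := by
    refine Continuous.measurable ?_
    fun_prop
  have : IsProbabilityMeasure ((multivariateGaussian 0 K).map
      (fun x => (WithLp.toLp 2 (T.mulVec x.ofLp) : E p))) :=
    Measure.isProbabilityMeasure_map hmeas.aemeasurable
  refine Measure.ext_of_charFun ?_
  ext t
  have : charFun ((multivariateGaussian 0 K).map (fun x => WithLp.toLp 2 (T.mulVec x.ofLp))) t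
      = charFun (multivariateGaussian 0 K) (WithLp.toLp 2 (T.transpose.mulVec t.ofLp)) := by
    rw [charFun_apply, charFun_apply, integral_map hmeas.aemeasurable (by fun_prop)]
    refine integral_congr_ae (Eventually.of_forall fun x => ?_)
    simp only
    congr 3
    simp only [EuclideanSpace.inner_eq_star_dotProduct, star_trivial]
    rw [Matrix.dotProduct_mulVec, Matrix.mulVec_transpose]
  rw [this, charFun_multivariateGaussian hK, charFun_multivariateGaussian hS]
  congr 2
  · simp
  · simp only [← Matrix.mulVec_mulVec]
    rw [Matrix.dotProduct_mulVec t.ofLp T, Matrix.mulVec_transpose]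

end CLT

/-! ### Tightness and negligible remainders -/

section Slutsky

variable {Ω Ω' : Type*} [MeasurableSpace Ω] {P : Measure Ω} [IsProbabilityMeasure P]
  [MeasurableSpace Ω'] {P' : Measure Ω'} [IsProbabilityMeasure P']

/-- Tightness: the limit law has small tails, and the portmanteau inequality for closed sets
transfers this to `Y n`. -/
lemma exists_eventually_measure_norm_ge_le {Y : ℕ → Ω → E p} {Z : Ω' → E p}
    (h : TendstoInDistribution Y atTop Z (fun _ => P) P') {ε : ENNReal} (hε : 0 < ε) :
    ∃ R : ℝ, 0 < R ∧ ∀ᶠ n in atTop, P {ω | R ≤ ‖Y n ω‖} ≤ ε := by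
  have hpm := Measure.isProbabilityMeasure_map h.aemeasurable_limit
  have hmeasR : ∀ R : ℝ, MeasurableSet {x : E p | R ≤ ‖x‖} := fun R =>
    measurableSet_le measurable_const measurable_norm
  have htail : Tendsto (fun k : ℕ => (P'.map Z) {x | (k : ℝ) + 1 ≤ ‖x‖}) atTop (𝓝 0) := by
    have := tendsto_measure_iInter_atTop (μ := P'.map Z)
      (s := fun k : ℕ => {x : E p | (k : ℝ) + 1 ≤ ‖x‖})
      (fun k => (hmeasR _).nullMeasurableSet)
      (fun i j hij x hx => by
        have : (i : ℝ) ≤ j := by exact_mod_cast hij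
        exact (add_le_add_left this 1).trans hx) ⟨0, measure_ne_top _ _⟩
    have hempty : ⋂ k : ℕ, {x : E p | (k : ℝ) + 1 ≤ ‖x‖} = ∅ := by
      ext x
      simp only [Set.mem_iInter, Set.mem_ofPred_eq, Set.mem_empty_iff_false, iff_false, not_forall,
        not_le]
      obtain ⟨k, hk⟩ := exists_nat_gt ‖x‖
      exact ⟨k, by linarith⟩
    rw [hempty, measure_empty] at this
    exact this
  obtain ⟨k, hk⟩ := (htail.eventually (gt_mem_nhds hε)).exists
  refine ⟨k + 1, by positivity, ?_⟩
  have hclosed : IsClosed {x : E p | (k : ℝ) + 1 ≤ ‖x‖} :=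
    isClosed_le continuous_const continuous_norm
  have hls := ProbabilityMeasure.limsup_measure_closed_le_of_tendsto h.tendsto hclosed
  have hlt := lt_of_le_of_lt hls hk
  filter_upwards [Filter.eventually_lt_of_limsup_lt hlt] with n hn
  have := hn.le
  simp only [ProbabilityMeasure.coe_mk] at this
  rwa [Measure.map_apply_of_aemeasurable (h.forall_aemeasurable n) (hmeasR _)] at this

/-- If `W n` is bounded by `c ‖Y n‖` with probability tending to one, for each `c > 0`, and `Y n`
converges in distribution, then `W n` converges to `0` in probability. -/
lemma tendstoInMeasure_zero_of_norm_le {Y W : ℕ → Ω → E p} {Z : Ω' → E p}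
    (h : TendstoInDistribution Y atTop Z (fun _ => P) P')
    (hW : ∀ c > 0, HighProb P (fun n ω => ‖W n ω‖ ≤ c * ‖Y n ω‖)) :
    TendstoInMeasure P W atTop 0 := by
  refine tendstoInMeasure_iff_highProb.2 fun ε hε => ?_
  refine ENNReal.tendsto_nhds_zero.2 fun η hη => ?_
  obtain ⟨R, hR, hev⟩ := exists_eventually_measure_norm_ge_le h (ENNReal.half_pos hη.ne')
  -- With the factor `ε / R`, the event `‖Y n‖ < R` forces `‖W n‖ < ε`.
  have h1 := ENNReal.tendsto_nhds_zero.1 (hW (ε / R) (by positivity)) (η / 2)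
    (ENNReal.half_pos hη.ne')
  filter_upwards [hev, h1] with n hn hn1
  refine (measure_mono fun ω hω => ?_).trans
    ((measure_union_le {ω | R ≤ ‖Y n ω‖} {ω | ¬ ‖W n ω‖ ≤ ε / R * ‖Y n ω‖}).trans
      ((add_le_add hn hn1).trans (ENNReal.add_halves η).le))
  by_contra hcon
  simp only [Set.mem_union, Set.mem_ofPred_eq, not_or, not_le, not_lt] at hcon
  apply hω
  simp only [Pi.zero_apply, sub_zero]
  calc ‖W n ω‖ ≤ ε / R * ‖Y n ω‖ := hcon.2
    _ < ε / R * R := by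
      have : 0 < ε / R := by positivity
      exact mul_lt_mul_of_pos_left hcon.1 this
    _ = ε := by field_simp

end Slutsky

/-! ### Derivatives of the model and of `V` -/

variable {𝒳 : Type*} [MeasurableSpace 𝒳]

-- Pulling out a constant factor needs no differentiability. This strips the density `g` from the
-- iterated derivatives in (A3).
omit [MeasurableSpace 𝒳] in
lemma paramDeriv_mul_right (k : Fin p) (φ : E p → 𝒳 → ℝ) (g : 𝒳 → ℝ) :
    paramDeriv k (fun θ x => φ θ x * g x) = fun θ x => paramDeriv k φ θ x * g x := by
  funext θ x
  simp only [paramDeriv, partialDeriv, lineDeriv]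
  exact deriv_mul_const_field _

lemma lineDifferentiableAt_of_mul_const {F : E p → ℝ} {a : ℝ} (ha : a ≠ 0) {θ e : E p}
    (h : LineDifferentiableAt ℝ (fun θ => F θ * a) θ e) : LineDifferentiableAt ℝ F θ e := by
  unfold LineDifferentiableAt at h ⊢
  have := h.mul_const a⁻¹
  simpa [mul_assoc, ha] using this

namespace Model

variable (𝓕 : Model p 𝒳)

/-- `B'(f_θ(x))`. -/
def derivTerm (B : ℝ → ℝ) (θ : E p) (x : 𝒳) : ℝ := deriv B (𝓕.f θ x)

/-- The points of the sample space at which the model depends regularly on the parameter. -/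
structure RegularAt (B : ℝ → ℝ) (N : Set (E p)) (x : 𝒳) : Prop where
  pos : ∀ θ ∈ 𝓕.Θ, 0 < 𝓕.f θ x
  contDiffOn : ContDiffOn ℝ 3 (fun θ => 𝓕.f θ x) N
  diff_one : ∀ l, ∀ θ ∈ N, LineDifferentiableAt ℝ (fun θ => 𝓕.derivTerm B θ x) θ
    (EuclideanSpace.single l 1)
  diff_two : ∀ k l, ∀ θ ∈ N, LineDifferentiableAt ℝ
    (fun θ => paramDeriv l (𝓕.derivTerm B) θ x) θ (EuclideanSpace.single k 1)
  diff_three : ∀ j k l, ∀ θ ∈ N, LineDifferentiableAt ℝ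
    (fun θ => paramDeriv k (paramDeriv l (𝓕.derivTerm B)) θ x) θ (EuclideanSpace.single j 1)

variable {𝓕} {B : ℝ → ℝ} {N : Set (E p)}

namespace RegularAt

variable {x : 𝒳} (hx : 𝓕.RegularAt B N x) (hB : IsGenerator B) (hN : IsOpen N) (hNΘ : N ⊆ 𝓕.Θ)
  {θ : E p} (hθ : θ ∈ N)

include hx hN hθ in
lemma hasLineDerivAt_density (l : Fin p) :
    HasLineDerivAt ℝ (fun θ => 𝓕.f θ x) (paramDeriv l 𝓕.f θ x) θ (EuclideanSpace.single l 1) :=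
  (((hx.contDiffOn.contDiffAt (hN.mem_nhds hθ)).differentiableAt
    (by norm_num)).lineDifferentiableAt).hasLineDerivAt

include hx hN hNΘ hθ in
lemma score_eq (l : Fin p) : 𝓕.score θ x l = paramDeriv l 𝓕.f θ x / 𝓕.f θ x := by
  have h := hx.hasLineDerivAt_density hN hθ l
  have h' := HasDerivAt.log h (by simpa using (hx.pos θ (hNΘ hθ)).ne')
  simp only [zero_smul, add_zero] at h'
  exact h'.deriv

include hx hB hN hNΘ hθ in
lemma paramDeriv_derivTerm (l : Fin p) :
    paramDeriv l (𝓕.derivTerm B) θ x = deriv (deriv B) (𝓕.f θ x) * paramDeriv l 𝓕.f θ x := by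
  have h := hx.hasLineDerivAt_density hN hθ l
  have hB' : HasDerivAt (deriv B) (deriv (deriv B) (𝓕.f θ x))
      (𝓕.f (θ + (0 : ℝ) • EuclideanSpace.single l 1) x) := by
    simpa using (hB.differentiableAt_deriv _ (hx.pos θ (hNΘ hθ))).hasDerivAt
  have h' := hB'.comp (0 : ℝ) h
  exact h'.deriv

include hx hB hN hNΘ hθ in
lemma score_mul_eq (l : Fin p) :
    𝓕.score θ x l * deriv (deriv B) (𝓕.f θ x) * 𝓕.f θ x = paramDeriv l (𝓕.derivTerm B) θ x := by
  have := (hx.pos θ (hNΘ hθ)).ne'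
  rw [hx.paramDeriv_derivTerm hB hN hNΘ hθ, hx.score_eq hN hNΘ hθ]
  field_simp

-- In the derivative of `f B'(f) - B(f)` the two terms `B'(f) ∂f` cancel.
include hx hB hN hNΘ hθ in
lemma paramDeriv_modelTerm (l : Fin p) :
    paramDeriv l (𝓕.modelTerm B) θ x = 𝓕.f θ x * paramDeriv l (𝓕.derivTerm B) θ x := by
  have h := hx.hasLineDerivAt_density hN hθ l
  have hb := (hx.diff_one l θ hθ).hasLineDerivAt
  have hB' : HasDerivAt B (deriv B (𝓕.f θ x))
      (𝓕.f (θ + (0 : ℝ) • EuclideanSpace.single l 1) x) := by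
    simpa using (hB.differentiableAt _ (hx.pos θ (hNΘ hθ))).hasDerivAt
  have h' := (HasDerivAt.mul h hb).sub (hB'.comp (0 : ℝ) h)
  refine (HasDerivAt.deriv h').trans ?_
  simp only [zero_smul, add_zero, derivTerm, paramDeriv, partialDeriv]
  ring

include hx hB hN hNΘ hθ in
lemma paramDeriv_paramDeriv_modelTerm (k l : Fin p) :
    paramDeriv k (paramDeriv l (𝓕.modelTerm B)) θ x =
      𝓕.score θ x k * 𝓕.score θ x l * deriv (deriv B) (𝓕.f θ x) * 𝓕.f θ x ^ 2
        + 𝓕.f θ x * paramDeriv k (paramDeriv l (𝓕.derivTerm B)) θ x := by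
  have hev : (fun θ => paramDeriv l (𝓕.modelTerm B) θ x) =ᶠ[𝓝 θ]
      fun θ => 𝓕.f θ x * paramDeriv l (𝓕.derivTerm B) θ x := by
    filter_upwards [hN.mem_nhds hθ] with θ' hθ'
    exact hx.paramDeriv_modelTerm hB hN hNΘ hθ' l
  have h' := HasDerivAt.mul (hx.hasLineDerivAt_density hN hθ k)
    (hx.diff_two k l θ hθ).hasLineDerivAt
  have hpos := (hx.pos θ (hNΘ hθ)).ne'
  have e : paramDeriv k (paramDeriv l (𝓕.modelTerm B)) θ x =
      paramDeriv k 𝓕.f θ x * paramDeriv l (𝓕.derivTerm B) θ x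
        + 𝓕.f θ x * paramDeriv k (paramDeriv l (𝓕.derivTerm B)) θ x := by
    refine hev.lineDeriv_eq.trans ((HasDerivAt.deriv h').trans ?_)
    simp only [zero_smul, add_zero]
    rfl
  rw [e, hx.score_eq hN hNΘ hθ, hx.score_eq hN hNΘ hθ, hx.paramDeriv_derivTerm hB hN hNΘ hθ]
  field_simp

end RegularAt

section Integrals

variable (𝓕 B) in
/-- The gradient of `∫ [f_θ B'(f_θ) - B(f_θ)] dx`. -/
def modelIntegralDeriv (l : Fin p) (θ : E p) : ℝ :=
  ∫ x, paramDeriv l (𝓕.modelTerm B) θ x ∂𝓕.base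

variable (𝓕 B) in
/-- The Hessian of `∫ [f_θ B'(f_θ) - B(f_θ)] dx`. -/
def modelIntegralDerivDeriv (k l : Fin p) (θ : E p) : ℝ :=
  ∫ x, paramDeriv k (paramDeriv l (𝓕.modelTerm B)) θ x ∂𝓕.base

variable (hA3 : DiffUnderIntegral 𝓕.base N 3 (𝓕.modelTerm B)) (hN : IsOpen N)
  {θ : E p} (hθ : θ ∈ N)

include hA3 hθ in
lemma RegularAt.hasLineDerivAt_V {x : 𝒳} (hx : 𝓕.RegularAt B N x) (l : Fin p) :
    HasLineDerivAt ℝ (fun θ => 𝓕.V B θ x)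
      (𝓕.modelIntegralDeriv B l θ - paramDeriv l (𝓕.derivTerm B) θ x) θ
      (EuclideanSpace.single l 1) :=
  HasDerivAt.sub ((hA3.2 l).2.1 θ hθ) (hx.diff_one l θ hθ).hasLineDerivAt

include hA3 hN hθ in
lemma RegularAt.hasLineDerivAt_paramDeriv_V {x : 𝒳} (hx : 𝓕.RegularAt B N x) (k l : Fin p) :
    HasLineDerivAt ℝ (fun θ => paramDeriv l (𝓕.V B) θ x)
      (𝓕.modelIntegralDerivDeriv B k l θ - paramDeriv k (paramDeriv l (𝓕.derivTerm B)) θ x) θ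
      (EuclideanSpace.single k 1) := by
  have h : HasLineDerivAt ℝ (fun θ => 𝓕.modelIntegralDeriv B l θ
      - paramDeriv l (𝓕.derivTerm B) θ x)
      (𝓕.modelIntegralDerivDeriv B k l θ - paramDeriv k (paramDeriv l (𝓕.derivTerm B)) θ x) θ
      (EuclideanSpace.single k 1) :=
    HasDerivAt.sub (((hA3.2 l).2.2.2 k).2.1 θ hθ) (hx.diff_two k l θ hθ).hasLineDerivAt
  refine h.congr_of_eventuallyEq ?_
  filter_upwards [hN.mem_nhds hθ] with θ' hθ'
  exact (hx.hasLineDerivAt_V hA3 hθ' l).lineDeriv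

-- The third derivative is needed only to exist: its bound (A5) then controls the variation of the
-- second derivatives.
include hA3 hN hθ in
lemma RegularAt.lineDifferentiableAt_paramDeriv_paramDeriv_V {x : 𝒳} (hx : 𝓕.RegularAt B N x)
    (j k l : Fin p) :
    LineDifferentiableAt ℝ (fun θ => paramDeriv k (paramDeriv l (𝓕.V B)) θ x) θ
      (EuclideanSpace.single j 1) := by
  have h := HasDerivAt.sub ((((hA3.2 l).2.2.2 k).2.2.2 j).2.1 θ hθ)
    (hx.diff_three j k l θ hθ).hasLineDerivAt
  have h' : LineDifferentiableAt ℝ (fun θ => 𝓕.modelIntegralDerivDeriv B k l θ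
      - paramDeriv k (paramDeriv l (𝓕.derivTerm B)) θ x) θ (EuclideanSpace.single j 1) :=
    h.differentiableAt
  refine h'.congr_of_eventuallyEq ?_
  filter_upwards [hN.mem_nhds hθ] with θ' hθ'
  exact (hx.hasLineDerivAt_paramDeriv_V hA3 hN hθ' k l).lineDeriv

end Integrals

/-! ### Integrals against the true distribution -/

section Support

variable {θ₀ : E p} (hθ₀ : θ₀ ∈ 𝓕.Θ) (hA1 : 𝓕.A1 (𝓕.f θ₀))

include hθ₀ hA1

lemma measurableSet_χ : MeasurableSet 𝓕.χ := by
  rw [← hA1.2]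
  exact measurableSet_lt measurable_const (𝓕.measurable θ₀ hθ₀)

lemma dist_eq_withDensity_base :
    𝓕.dist (𝓕.f θ₀) = 𝓕.base.withDensity (fun x => ENNReal.ofReal (𝓕.f θ₀ x)) := by
  rw [base, ← withDensity_indicator (measurableSet_χ hθ₀ hA1), dist]
  congr 1
  funext x
  by_cases hx : x ∈ 𝓕.χ
  · simp [hx]
  · rw [Set.indicator_of_notMem hx]
    rw [← hA1.2] at hx
    exact ENNReal.ofReal_of_nonpos (not_lt.1 hx)

lemma ae_dist_of_ae_base {q : 𝒳 → Prop} (h : ∀ᵐ x ∂𝓕.base, q x) : ∀ᵐ x ∂𝓕.dist (𝓕.f θ₀), q x := by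
  rw [dist_eq_withDensity_base hθ₀ hA1]
  exact (withDensity_absolutelyContinuous _ _).ae_le h

lemma integrable_dist_iff {q : 𝒳 → ℝ} :
    Integrable q (𝓕.dist (𝓕.f θ₀)) ↔ Integrable (fun x => q x * 𝓕.f θ₀ x) 𝓕.base := by
  rw [dist_eq_withDensity_base hθ₀ hA1, integrable_withDensity_iff_integrable_smul'
    (𝓕.measurable θ₀ hθ₀).ennreal_ofReal (by simp)]
  refine integrable_congr (Eventually.of_forall fun x => ?_)
  simp [ENNReal.toReal_ofReal (𝓕.nonneg θ₀ hθ₀ x), mul_comm]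

lemma integral_dist (q : 𝒳 → ℝ) :
    ∫ x, q x ∂𝓕.dist (𝓕.f θ₀) = ∫ x, q x * 𝓕.f θ₀ x ∂𝓕.base := by
  rw [dist_eq_withDensity_base hθ₀ hA1, integral_withDensity_eq_integral_toReal_smul
    (𝓕.measurable θ₀ hθ₀).ennreal_ofReal (by simp)]
  refine integral_congr_ae (Eventually.of_forall fun x => ?_)
  simp [ENNReal.toReal_ofReal (𝓕.nonneg θ₀ hθ₀ x), mul_comm]

omit hA1 in
lemma isProbabilityMeasure_dist : IsProbabilityMeasure (𝓕.dist (𝓕.f θ₀)) :=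
  ⟨by rw [dist, withDensity_apply _ MeasurableSet.univ]; simpa using 𝓕.lintegral_eq_one θ₀ hθ₀⟩

/-- Three derivatives of `B'(f_θ)` would require a fourth derivative of `B`, so the chain rule does
not suffice. They are read off from (A3) for `B'(f_θ) g`, after division by `g`, which is positive
on `χ`. -/
lemma ae_regularAt (hA2 : 𝓕.A2 N) (hA3 : 𝓕.A3 B (𝓕.f θ₀) N) :
    ∀ᵐ x ∂𝓕.base, 𝓕.RegularAt B N x := by
  have hφ : (fun θ x => deriv B (𝓕.f θ x) * 𝓕.f θ₀ x)
      = fun θ x => 𝓕.derivTerm B θ x * 𝓕.f θ₀ x := rfl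
  have h3 := hA3.2
  rw [hφ] at h3
  have h1 : ∀ l, _ := fun l => (h3.2 l).1
  have h2 : ∀ l k, _ := fun l k => ((h3.2 l).2.2.2 k).1
  have h4 : ∀ l k j, _ := fun l k j => (((h3.2 l).2.2.2 k).2.2.2 j).1
  simp only [paramDeriv_mul_right] at h2 h4
  have h1' := ae_all_iff.2 h1
  have h2' := ae_all_iff.2 fun l => ae_all_iff.2 (h2 l)
  have h4' := ae_all_iff.2 fun l => ae_all_iff.2 fun k => ae_all_iff.2 (h4 l k)
  have hχ : ∀ᵐ x ∂𝓕.base, x ∈ 𝓕.χ := ae_restrict_mem (measurableSet_χ hθ₀ hA1)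
  filter_upwards [h1', h2', h4', hχ, hA2] with x h1x h2x h4x hxχ hc
  have hpos : ∀ θ ∈ 𝓕.Θ, 0 < 𝓕.f θ x := fun θ hθ => by
    rw [← hA1.1 θ hθ] at hxχ
    exact hxχ
  have hne := (hpos θ₀ hθ₀).ne'
  exact ⟨hpos, hc, fun l θ hθ => lineDifferentiableAt_of_mul_const hne (h1x l θ hθ),
    fun k l θ hθ => lineDifferentiableAt_of_mul_const hne (h2x l k θ hθ),
    fun j k l θ hθ => lineDifferentiableAt_of_mul_const hne (h4x l k j θ hθ)⟩

end Support

/-! ### Moments and first order expansion of the score -/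

section Score

variable {θ₀ : E p} (hB : IsGenerator B) (hN : IsOpen N) (hNΘ : N ⊆ 𝓕.Θ)
  (hθ₀N : θ₀ ∈ N) (hA1 : 𝓕.A1 (𝓕.f θ₀)) (hA2 : 𝓕.A2 N) (hA3 : 𝓕.A3 B (𝓕.f θ₀) N)

include hB hN hNΘ hθ₀N hA1 hA2 hA3

lemma integral_score_mul_eq {θ : E p} (hθ : θ ∈ N) (l : Fin p) :
    ∫ t, 𝓕.score θ t l * deriv (deriv B) (𝓕.f θ t) * 𝓕.f θ t ^ 2 ∂𝓕.base
      = 𝓕.modelIntegralDeriv B l θ := by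
  refine integral_congr_ae ?_
  filter_upwards [ae_regularAt (hNΘ hθ₀N) hA1 hA2 hA3] with x hx
  rw [hx.paramDeriv_modelTerm hB hN hNΘ hθ, ← hx.score_mul_eq hB hN hNΘ hθ]
  ring

/-- `ψ(x, θ) = -∇_θ V_θ(x)`. -/
lemma psi_eq {x : 𝒳} (hx : 𝓕.RegularAt B N x) {θ : E p} (hθ : θ ∈ N) (l : Fin p) :
    𝓕.psi B x θ l = -paramDeriv l (𝓕.V B) θ x := by
  rw [psi, integral_score_mul_eq hB hN hNΘ hθ₀N hA1 hA2 hA3 hθ, hx.score_mul_eq hB hN hNΘ hθ]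
  have : paramDeriv l (𝓕.V B) θ x = _ := (hx.hasLineDerivAt_V hA3.1 hθ l).lineDeriv
  rw [this]
  ring

/-- At the true distribution, `J` is the matrix of the expectations `E_g[∇_{kl} V_θ(X)]`. -/
lemma integrable_and_integral_hessian (k l : Fin p) :
    Integrable (fun x => paramDeriv k (paramDeriv l (𝓕.V B)) θ₀ x) (𝓕.dist (𝓕.f θ₀)) ∧
    ∫ x, paramDeriv k (paramDeriv l (𝓕.V B)) θ₀ x ∂𝓕.dist (𝓕.f θ₀) = 𝓕.J B (𝓕.f θ₀) θ₀ k l := by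
  have hθ₀ := hNΘ hθ₀N
  have hprob := isProbabilityMeasure_dist (𝓕 := 𝓕) hθ₀
  have hreg := ae_regularAt hθ₀ hA1 hA2 hA3
  have hV : (fun x => paramDeriv k (paramDeriv l (𝓕.V B)) θ₀ x) =ᵐ[𝓕.dist (𝓕.f θ₀)] fun x =>
      𝓕.modelIntegralDerivDeriv B k l θ₀ - paramDeriv k (paramDeriv l (𝓕.derivTerm B)) θ₀ x := by
    filter_upwards [ae_dist_of_ae_base hθ₀ hA1 hreg] with x hx
    exact (hx.hasLineDerivAt_paramDeriv_V hA3.1 hN hθ₀N k l).lineDeriv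
  have hφ : (fun θ x => deriv B (𝓕.f θ x) * 𝓕.f θ₀ x)
      = fun θ x => 𝓕.derivTerm B θ x * 𝓕.f θ₀ x := rfl
  have hint0 := ((hA3.2.2 l).2.2.2 k).2.2.1 θ₀ hθ₀N
  simp only [hφ, paramDeriv_mul_right] at hint0
  have hint1 : Integrable (fun x => paramDeriv k (paramDeriv l (𝓕.derivTerm B)) θ₀ x)
      (𝓕.dist (𝓕.f θ₀)) := (integrable_dist_iff hθ₀ hA1).2 hint0
  have hint2 := ((hA3.1.2 l).2.2.2 k).2.2.1 θ₀ hθ₀N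
  refine ⟨((integrable_const _).sub hint1).congr hV.symm, ?_⟩
  rw [integral_congr_ae hV, integral_sub (integrable_const _) hint1, integral_const,
    integral_dist hθ₀ hA1]
  -- With `g = f_θ₀` the factor `g - f_θ` removes the second integral of `J`. Subtracting
  -- `E_g[∂²B'(f)]` from the Hessian of the model integral then leaves only the product of scores.
  simp only [probReal_univ, one_smul, J, Matrix.of_apply, sub_self, mul_zero, zero_mul,
    integral_zero, add_zero]
  rw [modelIntegralDerivDeriv, ← integral_sub hint2 hint0]
  refine integral_congr_ae ?_
  filter_upwards [hreg] with x hx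
  rw [hx.paramDeriv_paramDeriv_modelTerm hB hN hNΘ hθ₀N]
  ring

lemma J_eq_hessianV : 𝓕.J B (𝓕.f θ₀) θ₀ = 𝓕.hessianV B (𝓕.f θ₀) θ₀ := by
  ext k l
  exact (integrable_and_integral_hessian hB hN hNΘ hθ₀N hA1 hA2 hA3 k l).2.symm

-- Because `g = f_θ₀`, one factor `f_θ₀` of the centring integral becomes the density of `G`, and
-- the integral is `ξ`.
omit hB hN hA2 hA3 in
lemma psi_eq_score_mul_weight (x : 𝒳) (l : Fin p) :
    𝓕.psi B x θ₀ l = 𝓕.score θ₀ x l * weight B (𝓕.f θ₀ x) - 𝓕.ξ B (𝓕.f θ₀) θ₀ l := by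
  rw [psi, ξ, integral_dist (hNΘ hθ₀N) hA1]
  simp only [weight]
  congr 1
  · ring
  · congr 1
    funext t
    ring

/-- The moments of the score at the true parameter. -/
lemma psi_moments (hK : 𝓕.FiniteK B (𝓕.f θ₀) θ₀) :
    (∀ l, MemLp (fun x => 𝓕.psi B x θ₀ l) 2 (𝓕.dist (𝓕.f θ₀))) ∧
    (∀ l, ∫ x, 𝓕.psi B x θ₀ l ∂𝓕.dist (𝓕.f θ₀) = 0) ∧
    ∀ k l, ∫ x, 𝓕.psi B x θ₀ k * 𝓕.psi B x θ₀ l ∂𝓕.dist (𝓕.f θ₀) = 𝓕.K B (𝓕.f θ₀) θ₀ k l := by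
  have hθ₀ := hNΘ hθ₀N
  have hprob := isProbabilityMeasure_dist (𝓕 := 𝓕) hθ₀
  have hreg := ae_regularAt hθ₀ hA1 hA2 hA3
  set u : Fin p → 𝒳 → ℝ := fun l x => 𝓕.score θ₀ x l * weight B (𝓕.f θ₀ x) with hu
  have hpsi : ∀ x l, 𝓕.psi B x θ₀ l = u l x - 𝓕.ξ B (𝓕.f θ₀) θ₀ l :=
    psi_eq_score_mul_weight hNΘ hθ₀N hA1
  have hξ : ∀ l, ∫ x, u l x ∂𝓕.dist (𝓕.f θ₀) = 𝓕.ξ B (𝓕.f θ₀) θ₀ l := fun l => rfl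
  have hφ : (fun θ x => deriv B (𝓕.f θ x) * 𝓕.f θ₀ x)
      = fun θ x => 𝓕.derivTerm B θ x * 𝓕.f θ₀ x := rfl
  -- Finiteness of `K` only yields measurability of products of scores. That of a single weighted
  -- score comes from (A3), since it equals a derivative of `B'(f_θ)`.
  have hmeas : ∀ l, AEStronglyMeasurable (u l) (𝓕.dist (𝓕.f θ₀)) := fun l => by
    have hint0 := (hA3.2.2 l).2.2.1 θ₀ hθ₀N
    simp only [hφ, paramDeriv_mul_right] at hint0
    have hint1 : Integrable (fun x => paramDeriv l (𝓕.derivTerm B) θ₀ x) (𝓕.dist (𝓕.f θ₀)) :=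
      (integrable_dist_iff hθ₀ hA1).2 hint0
    refine hint1.1.congr ?_
    filter_upwards [ae_dist_of_ae_base hθ₀ hA1 hreg] with x hx
    rw [← hx.score_mul_eq hB hN hNΘ hθ₀N, hu]
    simp only [weight]
    ring
  have hL2 : ∀ l, MemLp (u l) 2 (𝓕.dist (𝓕.f θ₀)) := fun l => by
    rw [memLp_two_iff_integrable_sq (hmeas l)]
    refine (hK l l).congr (Eventually.of_forall fun x => ?_)
    simp only [hu]
    ring
  have hL1 : ∀ l, Integrable (u l) (𝓕.dist (𝓕.f θ₀)) := fun l => (hL2 l).integrable (by norm_num)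
  simp only [hpsi]
  refine ⟨fun l => (hL2 l).sub (memLp_const _), fun l => ?_, fun k l => ?_⟩
  · rw [integral_sub (hL1 l) (integrable_const _), hξ]
    simp
  · have hkl : Integrable (fun x => u k x * u l x) (𝓕.dist (𝓕.f θ₀)) :=
      (hL2 k).integrable_mul (hL2 l)
    set a := 𝓕.ξ B (𝓕.f θ₀) θ₀ k
    set b := 𝓕.ξ B (𝓕.f θ₀) θ₀ l
    have e : ∀ x, (u k x - a) * (u l x - b) = u k x * u l x - b * u k x - (a * u l x - a * b) :=
      fun x => by ring
    simp only [e]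
    have h1 : Integrable (fun x => u k x * u l x - b * u k x) (𝓕.dist (𝓕.f θ₀)) :=
      hkl.sub ((hL1 k).const_mul b)
    have h2 : Integrable (fun x => a * u l x - a * b) (𝓕.dist (𝓕.f θ₀)) :=
      ((hL1 l).const_mul a).sub (integrable_const _)
    rw [integral_sub h1 h2, integral_sub hkl ((hL1 k).const_mul b),
      integral_sub ((hL1 l).const_mul a)
      (integrable_const _), integral_const_mul, integral_const_mul, hξ, hξ]
    simp only [integral_const, probReal_univ, one_smul, K, Matrix.of_apply]
    have : ∀ x, 𝓕.score θ₀ x k * 𝓕.score θ₀ x l * weight B (𝓕.f θ₀ x) ^ 2 = u k x * u l x :=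
      fun x => by simp only [hu]; ring
    simp only [this]
    ring

/-- A set of full measure on which the score is measurable and has a first order expansion in the
parameter, with an integrable remainder. -/
lemma exists_regular_set (hA5 : 𝓕.A5 B (𝓕.f θ₀) N) :
    ∃ S : Set 𝒳, MeasurableSet S ∧ (∀ᵐ x ∂𝓕.dist (𝓕.f θ₀), x ∈ S) ∧
      (∀ θ ∈ N, ∀ l, Measurable (S.indicator fun x => 𝓕.psi B x θ l)) ∧
      ∃ D : 𝒳 → ℝ, Integrable D (𝓕.dist (𝓕.f θ₀)) ∧
        ∀ x ∈ S, ∀ δ > 0, cube θ₀ δ ⊆ N → ∀ θ₁ ∈ cube θ₀ δ, ∀ θ₂ ∈ cube θ₀ δ, ∀ l,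
          |𝓕.psi B x θ₁ l - 𝓕.psi B x θ₂ l
            + ∑ k, paramDeriv k (paramDeriv l (𝓕.V B)) θ₀ x * (θ₁ k - θ₂ k)|
            ≤ D x * (p * δ) * ∑ k, |θ₁ k - θ₂ k| := by
  have hθ₀ := hNΘ hθ₀N
  choose D hDint hDb using hA5
  have hDb' := ae_all_iff.2 fun j => ae_all_iff.2 fun k => ae_all_iff.2 fun l => hDb j k l
  obtain ⟨S, hSae, hSm, hS⟩ := (((ae_dist_of_ae_base hθ₀ hA1
    (ae_regularAt hθ₀ hA1 hA2 hA3)).and hDb')).exists_measurable_mem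
  have hpsi : ∀ x ∈ S, ∀ θ ∈ N, ∀ l, 𝓕.psi B x θ l = -paramDeriv l (𝓕.V B) θ x :=
    fun x hx θ hθ l => psi_eq hB hN hNΘ hθ₀N hA1 hA2 hA3 (hS x hx).1 hθ l
  refine ⟨S, hSm, hSae, fun θ hθ l => ?_, fun x => ∑ j, ∑ k, ∑ l, |D j k l x|, ?_, ?_⟩
  -- On `S` the score is, up to a constant in `x`, the limit of measurable difference quotients of
  -- `B'(f_θ)`. The shift by `n₀` keeps the displaced parameters in `N`, where the densities are
  -- measurable.
  · have hB' : Measurable (deriv B) := measurable_deriv B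
    have hmove : Tendsto (fun n : ℕ => θ + ((n : ℝ) + 1)⁻¹ • EuclideanSpace.single l (1 : ℝ)) atTop
        (𝓝 θ) := by
      have h0 : Tendsto (fun n : ℕ => ((n : ℝ) + 1)⁻¹) atTop (𝓝 0) := by
        simpa using tendsto_one_div_add_atTop_nhds_zero_nat (𝕜 := ℝ)
      simpa using tendsto_const_nhds.add (h0.smul_const (EuclideanSpace.single l (1 : ℝ)))
    obtain ⟨n₀, hn₀⟩ := eventually_atTop.1 (hmove.eventually (hN.mem_nhds hθ))
    refine measurable_of_tendsto_metrizable (f := fun n : ℕ => S.indicator fun x =>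
      (((n + n₀ : ℕ) : ℝ) + 1) * (𝓕.derivTerm B
        (θ + (((n + n₀ : ℕ) : ℝ) + 1)⁻¹ • EuclideanSpace.single l (1 : ℝ)) x - 𝓕.derivTerm B θ x)
        - 𝓕.modelIntegralDeriv B l θ) (fun n => ?_) ?_
    · refine Measurable.indicator ?_ hSm
      exact (((hB'.comp (𝓕.measurable _ (hNΘ (hn₀ _ (Nat.le_add_left _ _))))).sub
        (hB'.comp (𝓕.measurable _ (hNΘ hθ)))).const_mul _).sub_const _
    · refine tendsto_pi_nhds.2 fun x => ?_
      by_cases hx : x ∈ S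
      · simp only [Set.indicator_of_mem hx, hpsi x hx θ hθ l]
        have hr := (hS x hx).1
        have hslope := hasLineDerivAt_iff_tendsto_slope_zero.1
          (hr.diff_one l θ hθ).hasLineDerivAt
        have hlim : Tendsto (fun n : ℕ => (((n + n₀ : ℕ) : ℝ) + 1)⁻¹) atTop (𝓝[≠] 0) := by
          refine tendsto_nhdsWithin_iff.2 ⟨?_, Eventually.of_forall fun n => ?_⟩
          · have h0 : Tendsto (fun n : ℕ => ((n : ℝ) + 1)⁻¹) atTop (𝓝 0) := by
              simpa using tendsto_one_div_add_atTop_nhds_zero_nat (𝕜 := ℝ)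
            exact h0.comp (tendsto_add_atTop_nat n₀)
          · have : (0 : ℝ) < (((n + n₀ : ℕ) : ℝ) + 1)⁻¹ := by positivity
            exact this.ne'
        have h2 := (hslope.comp hlim).sub_const (𝓕.modelIntegralDeriv B l θ)
        have hV : paramDeriv l (𝓕.V B) θ x = _ := (hr.hasLineDerivAt_V hA3.1 hθ l).lineDeriv
        rw [hV, neg_sub]
        refine h2.congr fun n => ?_
        simp
      · simp [Set.indicator_of_notMem hx]
  · exact integrable_finsetSum _ fun j _ => integrable_finsetSum _ fun k _ =>
      integrable_finsetSum _ fun l _ => (hDint j k l).abs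
  · intro x hx δ hδ hcube θ₁ h₁ θ₂ h₂ l
    obtain ⟨hr, hb⟩ := hS x hx
    have := abs_sub_sub_le_of_partialDeriv_partialDeriv_le
      (h := fun θ => paramDeriv l (𝓕.V B) θ x) (c := θ₀) (δ := δ)
      (C := ∑ j, ∑ k, ∑ l, |D j k l x|) hδ
      (Finset.sum_nonneg fun j _ => Finset.sum_nonneg fun k _ => Finset.sum_nonneg fun l _ =>
        abs_nonneg _)
      (fun k θ hθ => (hr.hasLineDerivAt_paramDeriv_V hA3.1 hN (hcube hθ) k l).lineDifferentiableAt)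
      (fun j k θ hθ => hr.lineDifferentiableAt_paramDeriv_paramDeriv_V hA3.1 hN (hcube hθ) j k l)
      (fun j k θ hθ => by
        calc _ ≤ |D j k l x| := (hb j k l θ (hcube hθ)).trans (le_abs_self _)
          _ ≤ ∑ l, |D j k l x| := Finset.single_le_sum (f := fun l => |D j k l x|)
              (fun l _ => abs_nonneg _) (Finset.mem_univ l)
          _ ≤ ∑ k, ∑ l, |D j k l x| := Finset.single_le_sum (f := fun k => ∑ l, |D j k l x|)
              (fun k _ => Finset.sum_nonneg fun l _ => abs_nonneg _) (Finset.mem_univ k)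
          _ ≤ _ := Finset.single_le_sum (f := fun j => ∑ k, ∑ l, |D j k l x|)
              (fun j _ => Finset.sum_nonneg fun k _ => Finset.sum_nonneg fun l _ => abs_nonneg _)
              (Finset.mem_univ j)) h₁ h₂
    refine le_trans (le_of_eq ?_) this
    rw [hpsi x hx _ (hcube h₁), hpsi x hx _ (hcube h₂), ← abs_neg]
    congr 1
    simp only [paramDeriv]
    ring

end Score

end Model

/-! ### Regularity of the restrictions -/

section Constraints

lemma fderiv_apply_eq_transpose_mulVec {m : E p → Fin r → ℝ} {θ : E p}
    (hm : DifferentiableAt ℝ m θ) (v : E p) :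
    fderiv ℝ m θ v = (constraintMatrix m θ).transpose.mulVec v.ofLp := by
  funext l
  have hl : ∀ j, constraintMatrix m θ j l = fderiv ℝ m θ (EuclideanSpace.single j 1) l := fun j => by
    have h := (hasFDerivAt_pi'.1 hm.hasFDerivAt l).hasLineDerivAt (EuclideanSpace.single j 1)
    exact h.lineDeriv
  conv_lhs => rw [eq_sum_smul_single v]
  simp only [map_sum, map_smul, Finset.sum_apply, Pi.smul_apply, smul_eq_mul, Matrix.mulVec,
    dotProduct, Matrix.transpose_apply, hl]
  exact Finset.sum_congr rfl fun j _ => mul_comm _ _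

/-- A `C¹` map is strictly differentiable, so two arbitrary points near `θ₀` can be compared, as the
contraction argument requires. -/
lemma exists_constraint_approx {m : E p → Fin r → ℝ} {θ₀ : E p} (hm : ContDiffAt ℝ 1 m θ₀) {c : ℝ}
    (hc : 0 < c) :
    ∃ δ > 0, ∀ θ₁ ∈ Metric.closedBall θ₀ δ, ∀ θ₂ ∈ Metric.closedBall θ₀ δ,
      ‖m θ₁ - m θ₂ - (constraintMatrix m θ₀).transpose.mulVec (θ₁ - θ₂).ofLp‖
        ≤ c * ‖θ₁ - θ₂‖ := by
  have hs := hm.hasStrictFDerivAt (by norm_num)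
  obtain ⟨s, hsn, hsa⟩ := hs.approximates_deriv_on_nhds (c := ⟨c, hc.le⟩) (Or.inr hc)
  obtain ⟨δ, hδ, hball⟩ := Metric.nhds_basis_closedBall.mem_iff.1 hsn
  refine ⟨δ, hδ, fun θ₁ h₁ θ₂ h₂ => ?_⟩
  rw [← fderiv_apply_eq_transpose_mulVec (hm.differentiableAt (by norm_num))]
  exact hsa θ₁ (hball h₁) θ₂ (hball h₂)

lemma A6.exists_lipschitz {m : E p → Fin r → ℝ} {N : Set (E p)} (hA6 : A6 m N) {θ₀ : E p} {δ : ℝ}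
    (hδ : cube θ₀ δ ⊆ N) :
    ∃ L, 0 ≤ L ∧ ∀ θ₁ ∈ cube θ₀ δ, ∀ θ₂ ∈ cube θ₀ δ, ∀ j l,
      |constraintMatrix m θ₁ j l - constraintMatrix m θ₂ j l| ≤ L * ‖θ₁ - θ₂‖ := by
  choose hd C hC using hA6
  set C' := ∑ i, ∑ j, ∑ l, |C i j l| with hC'
  have hC0 : 0 ≤ C' := Finset.sum_nonneg fun j _ => Finset.sum_nonneg fun k _ =>
    Finset.sum_nonneg fun l _ => abs_nonneg _
  have hle : ∀ i j l, |C i j l| ≤ C' := fun i j l => by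
    calc |C i j l| ≤ ∑ l, |C i j l| := Finset.single_le_sum (f := fun l => |C i j l|)
          (fun l _ => abs_nonneg _) (Finset.mem_univ l)
      _ ≤ ∑ j, ∑ l, |C i j l| := Finset.single_le_sum (f := fun j => ∑ l, |C i j l|)
          (fun k _ => Finset.sum_nonneg fun l _ => abs_nonneg _) (Finset.mem_univ j)
      _ ≤ C' := Finset.single_le_sum (f := fun i => ∑ j, ∑ l, |C i j l|)
          (fun j _ => Finset.sum_nonneg fun k _ => Finset.sum_nonneg fun l _ => abs_nonneg _)
          (Finset.mem_univ i)
  refine ⟨C' * p, by positivity, fun θ₁ h₁ θ₂ h₂ j l => ?_⟩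
  have := abs_sub_le_of_partialDeriv_le (h := partialDeriv j fun θ => m θ l) (C := C')
    (fun i θ hθ => hd i j l θ (hδ hθ))
    (fun i θ hθ => ((hC i j l θ (hδ hθ)).trans (le_abs_self _)).trans (hle i j l)) h₁ h₂
  refine this.trans ?_
  rw [mul_assoc]
  exact mul_le_mul_of_nonneg_left (sum_abs_le_norm (θ₁ - θ₂)) hC0

end Constraints

/-- A function with a first order expansion on a set is Lipschitz on it. -/
lemma continuousOn_of_abs_sub_add_le {h : E p → ℝ} {s : Set (E p)} {a : Fin p → ℝ} {C : ℝ}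
    (H : ∀ θ₁ ∈ s, ∀ θ₂ ∈ s,
      |h θ₁ - h θ₂ + ∑ k, a k * (θ₁ k - θ₂ k)| ≤ C * ∑ k, |θ₁ k - θ₂ k|) :
    ContinuousOn h s := by
  have hlip : LipschitzOnWith (Real.toNNReal (|C| * p)) (fun θ => h θ + ∑ k, a k * θ k) s := by
    refine LipschitzOnWith.of_dist_le_mul fun θ₁ h₁ θ₂ h₂ => ?_
    rw [Real.coe_toNNReal _ (by positivity), Real.dist_eq, dist_eq_norm]
    have e : h θ₁ + ∑ k, a k * θ₁ k - (h θ₂ + ∑ k, a k * θ₂ k)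
        = h θ₁ - h θ₂ + ∑ k, a k * (θ₁ k - θ₂ k) := by
      simp only [mul_sub, Finset.sum_sub_distrib]
      ring
    rw [e, mul_assoc]
    refine (H θ₁ h₁ θ₂ h₂).trans ?_
    exact mul_le_mul (le_abs_self C) (sum_abs_le_norm (θ₁ - θ₂))
      (Finset.sum_nonneg fun k _ => abs_nonneg _) (abs_nonneg _)
  have hc : Continuous fun θ : E p => ∑ k, a k * θ k := by fun_prop
  refine (hlip.continuousOn.sub hc.continuousOn).congr fun θ _ => ?_
  simp

/-! ### Uniform linearization of the averaged score -/

section Average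

/-- The average `n⁻¹ ∑ ψ(x_i, θ)`. -/
def avgScore (ψ : 𝒳 → E p → Fin p → ℝ) {n : ℕ} (x : Fin n → 𝒳) (θ : E p) (k : Fin p) : ℝ :=
  (n : ℝ)⁻¹ * ∑ i, ψ (x i) θ k

variable {Ω : Type*} [MeasurableSpace Ω] {P : Measure Ω}
  [IsProbabilityMeasure P] {Q : Measure 𝒳} {X : ℕ → Ω → 𝒳} (hX : ∀ i, Measurable (X i))
  (hindep : iIndepFun X P) (hlaw : ∀ i, P.map (X i) = Q) {ψ : 𝒳 → E p → Fin p → ℝ} {θ₀ : E p}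

include hX hindep hlaw

lemma highProb_norm_avgScore_lt (hint : ∀ l, Integrable (fun x => ψ x θ₀ l) Q)
    (hmean : ∀ l, ∫ x, ψ x θ₀ l ∂Q = 0) {ε : ℝ} (hε : 0 < ε) :
    HighProb P fun n ω => ‖avgScore ψ (fun i : Fin n => X i ω) θ₀‖ < ε := by
  have h := HighProb.forall_fintype fun l =>
    highProb_average_sub_lt hX hindep hlaw (hint l) hε
  refine h.mono (Eventually.of_forall fun ω n hn => (pi_norm_lt_iff hε).2 fun l => ?_)
  have := hn l
  rw [hmean, sub_zero] at this
  exact this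

/-- Around `θ₀` the averaged score is nearly linear, with probability tending to one. -/
lemma exists_highProb_avgScore_approx {S : Set 𝒳} (hS : ∀ᵐ x ∂Q, x ∈ S) {N : Set (E p)}
    (hN : IsOpen N) (hθ₀ : θ₀ ∈ N) {H : Fin p → Fin p → 𝒳 → ℝ} {D : 𝒳 → ℝ}
    (hD : Integrable D Q) (hH : ∀ k l, Integrable (H k l) Q) {J : Matrix (Fin p) (Fin p) ℝ}
    (hJ : ∀ l k, J l k = ∫ x, H k l x ∂Q)
    (hexp : ∀ x ∈ S, ∀ δ > 0, cube θ₀ δ ⊆ N → ∀ θ₁ ∈ cube θ₀ δ, ∀ θ₂ ∈ cube θ₀ δ, ∀ l,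
      |ψ x θ₁ l - ψ x θ₂ l + ∑ k, H k l x * (θ₁ k - θ₂ k)|
        ≤ D x * (p * δ) * ∑ k, |θ₁ k - θ₂ k|) {c : ℝ} (hc : 0 < c) :
    ∃ δ₁ > 0, ∀ δ ≤ δ₁, HighProb P fun n ω =>
      ∀ θ₁ ∈ Metric.closedBall θ₀ δ, ∀ θ₂ ∈ Metric.closedBall θ₀ δ,
        ‖avgScore ψ (fun i : Fin n => X i ω) θ₁ - avgScore ψ (fun i : Fin n => X i ω) θ₂
          + J.mulVec (θ₁ - θ₂).ofLp‖ ≤ c * ‖θ₁ - θ₂‖ := by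
  obtain ⟨δ₀, hδ₀, hcube₀⟩ := exists_cube_subset hN hθ₀
  -- With high probability `d` bounds the average of `D`. The choice of `δ'` makes the Taylor
  -- remainder at most `η * τ`, the law of large numbers for the Hessian costs another `η * τ`, and
  -- `2 * η * τ ≤ c * ‖θ₁ - θ₂‖`.
  set d := |∫ x, D x ∂Q| + 1 with hd
  have hd0 : 0 < d := by positivity
  set η := c / (2 * (p + 1)) with hη
  have hη0 : 0 < η := by positivity
  set δ' := min δ₀ (η / (d * (p + 1))) with hδ'
  have hδ'0 : 0 < δ' := by positivity
  refine ⟨δ' / 2, by positivity, fun δ hδ => ?_⟩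
  have hball : Metric.closedBall θ₀ δ ⊆ cube θ₀ δ' :=
    (Metric.closedBall_subset_ball (by linarith)).trans (ball_subset_cube _ _)
  have hcube : cube θ₀ δ' ⊆ N := (cube_mono _ (min_le_left _ _)).trans hcube₀
  have hS' : ∀ᵐ ω ∂P, ∀ i, X i ω ∈ S :=
    ae_all_iff.2 fun i => ae_of_ae_map (hX i).aemeasurable (by rw [hlaw i]; exact hS)
  have hHP := HighProb.forall_fintype fun kl : Fin p × Fin p =>
    highProb_average_sub_lt hX hindep hlaw (hH kl.1 kl.2) hη0
  have hDP := highProb_average_sub_lt hX hindep hlaw hD one_pos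
  refine (hHP.and hDP).mono ?_
  filter_upwards [hS'] with ω hω n hn θ₁ h₁ θ₂ h₂
  obtain ⟨hHn, hDn⟩ := hn
  set Dn := (n : ℝ)⁻¹ * ∑ i : Fin n, D (X i ω) with hDn'
  have hDle : Dn ≤ d := by
    have := (abs_lt.1 hDn).2
    have := le_abs_self (∫ x, D x ∂Q)
    linarith
  set τ := ∑ k, |θ₁ k - θ₂ k| with hτ
  have hτ0 : 0 ≤ τ := Finset.sum_nonneg fun k _ => abs_nonneg _
  have hτp : τ ≤ p * ‖θ₁ - θ₂‖ := sum_abs_le_norm (θ₁ - θ₂)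
  refine (pi_norm_le_iff_of_nonneg (by positivity)).2 fun l => ?_
  set Hn : Fin p → ℝ := fun k => (n : ℝ)⁻¹ * ∑ i : Fin n, H k l (X i ω) with hHn'
  have hn0 : 0 ≤ (n : ℝ)⁻¹ := by positivity
  have e1 : avgScore ψ (fun i : Fin n => X i ω) θ₁ l - avgScore ψ (fun i : Fin n => X i ω) θ₂ l
      + ∑ k, Hn k * (θ₁ k - θ₂ k) = (n : ℝ)⁻¹ * ∑ i : Fin n,
        (ψ (X i ω) θ₁ l - ψ (X i ω) θ₂ l + ∑ k, H k l (X i ω) * (θ₁ k - θ₂ k)) := by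
    have e0 : ∑ k, Hn k * (θ₁ k - θ₂ k) = (n : ℝ)⁻¹ * ∑ i : Fin n, ∑ k,
        H k l (X i ω) * (θ₁ k - θ₂ k) := by
      simp_rw [hHn', mul_assoc, Finset.sum_mul]
      rw [← Finset.mul_sum, Finset.sum_comm]
    rw [e0, Finset.sum_add_distrib, Finset.sum_sub_distrib, mul_add, mul_sub]
    rfl
  have e2 : |avgScore ψ (fun i : Fin n => X i ω) θ₁ l - avgScore ψ (fun i : Fin n => X i ω) θ₂ l
      + ∑ k, Hn k * (θ₁ k - θ₂ k)| ≤ Dn * (p * δ') * τ := by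
    rw [e1, abs_mul, abs_of_nonneg hn0, hDn', mul_assoc, mul_assoc]
    refine mul_le_mul_of_nonneg_left ?_ hn0
    rw [Finset.sum_mul]
    refine (Finset.abs_sum_le_sum_abs _ _).trans (Finset.sum_le_sum fun i _ => ?_)
    rw [← mul_assoc]
    exact hexp _ (hω i) δ' hδ'0 hcube θ₁ (hball h₁) θ₂ (hball h₂) l
  have e3 : |∑ k, (J l k - Hn k) * (θ₁ k - θ₂ k)| ≤ η * τ := by
    refine (Finset.abs_sum_le_sum_abs _ _).trans ?_
    rw [hτ, Finset.mul_sum]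
    refine Finset.sum_le_sum fun k _ => ?_
    rw [abs_mul]
    refine mul_le_mul_of_nonneg_right ?_ (abs_nonneg _)
    rw [hJ, abs_sub_comm]
    exact (hHn (k, l)).le
  have e4 : avgScore ψ (fun i : Fin n => X i ω) θ₁ l - avgScore ψ (fun i : Fin n => X i ω) θ₂ l
      + J.mulVec (θ₁ - θ₂).ofLp l =
      (avgScore ψ (fun i : Fin n => X i ω) θ₁ l - avgScore ψ (fun i : Fin n => X i ω) θ₂ l
      + ∑ k, Hn k * (θ₁ k - θ₂ k)) + ∑ k, (J l k - Hn k) * (θ₁ k - θ₂ k) := by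
    simp only [Matrix.mulVec, dotProduct, PiLp.sub_apply, sub_mul,
      Finset.sum_sub_distrib]
    ring
  have e5 : Dn * (p * δ') * τ ≤ η * τ := by
    refine mul_le_mul_of_nonneg_right ?_ hτ0
    have h1 : δ' ≤ η / (d * (p + 1)) := min_le_right _ _
    have h2 : Dn * (p * δ') ≤ d * ((p + 1) * δ') := by
      refine mul_le_mul hDle ?_ (by positivity) hd0.le
      nlinarith
    refine h2.trans ?_
    rw [le_div_iff₀ (by positivity)] at h1
    linarith
  have e6 : 2 * η * τ ≤ c * ‖θ₁ - θ₂‖ := by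
    have h1 : 2 * η * (p + 1) = c := by rw [hη]; field_simp
    have h2 : 2 * η * τ ≤ 2 * η * (p * ‖θ₁ - θ₂‖) := mul_le_mul_of_nonneg_left hτp (by positivity)
    have h3 : 2 * η * (p * ‖θ₁ - θ₂‖) ≤ 2 * η * ((p + 1) * ‖θ₁ - θ₂‖) :=
      mul_le_mul_of_nonneg_left (by nlinarith [norm_nonneg (θ₁ - θ₂)]) (by positivity)
    nlinarith
  change |avgScore ψ (fun i : Fin n => X i ω) θ₁ l - avgScore ψ (fun i : Fin n => X i ω) θ₂ l
      + J.mulVec (θ₁ - θ₂).ofLp l| ≤ _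
  rw [e4]
  refine (abs_add_le _ _).trans ?_
  linarith

end Average

/-! ### Measurable construction of the root -/

section Retraction

variable {Z : Type*} [NormedAddCommGroup Z] [NormedSpace ℝ Z]

/-- The radial retraction onto the closed ball of centre `z₀` and radius `δ`. -/
def ballRetract (z₀ : Z) (δ : ℝ) (z : Z) : Z := z₀ + (δ / max δ ‖z - z₀‖) • (z - z₀)

variable {z₀ : Z} {δ : ℝ} (hδ : 0 < δ)

include hδ

lemma continuous_ballRetract : Continuous (ballRetract z₀ δ) := by
  unfold ballRetract
  refine continuous_const.add (Continuous.smul (continuous_const.div ?_ fun z => ?_) (by fun_prop))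
  · fun_prop
  · exact (lt_max_of_lt_left hδ).ne'

lemma ballRetract_mem (z : Z) : ballRetract z₀ δ z ∈ Metric.closedBall z₀ δ := by
  have h : 0 < max δ ‖z - z₀‖ := lt_max_of_lt_left hδ
  rw [mem_closedBall_iff_norm, ballRetract, add_sub_cancel_left, norm_smul, Real.norm_eq_abs,
    abs_of_pos (by positivity), div_mul_eq_mul_div, div_le_iff₀ h]
  exact mul_le_mul_of_nonneg_left (le_max_right _ _) hδ.le

lemma ballRetract_eq {z : Z} (hz : z ∈ Metric.closedBall z₀ δ) : ballRetract z₀ δ z = z := by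
  rw [mem_closedBall_iff_norm] at hz
  rw [ballRetract, max_eq_left hz, div_self hδ.ne', one_smul, add_sub_cancel]

end Retraction

lemma measurable_iterate {α Z : Type*} [MeasurableSpace α] [MeasurableSpace Z] {step : Z → α → Z}
    (h : Measurable (Function.uncurry step)) (z₀ : Z) (k : ℕ) :
    Measurable fun x => (fun z => step z x)^[k] z₀ := by
  induction k with
  | zero => exact measurable_const
  | succ k ih =>
    simp only [Function.iterate_succ_apply']
    exact h.comp (ih.prodMk measurable_id)

/-- The simplified Newton iteration finds a root of the restricted estimating equations as a
measurable function of the sample. -/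
lemma exists_measurable_root {A : (E p × (Fin r → ℝ)) ≃L[ℝ] ((Fin p → ℝ) × (Fin r → ℝ))}
    {Mf : E p → Matrix (Fin p) (Fin r) ℝ} {m : E p → Fin r → ℝ} {θ₀ : E p} {c δ : ℝ} (hδ : 0 < δ)
    (hc : 0 ≤ c) (hA : ‖(A.symm : ((Fin p → ℝ) × (Fin r → ℝ)) →L[ℝ] (E p × (Fin r → ℝ)))‖ * c ≤ 1 / 2) (hm₀ : m θ₀ = 0)
    (hMf : ContinuousOn Mf (Metric.closedBall θ₀ δ)) (hm : ContinuousOn m (Metric.closedBall θ₀ δ))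
    {ψ : 𝒳 → E p → Fin p → ℝ}
    (hψm : ∀ θ ∈ Metric.closedBall θ₀ δ, ∀ l, Measurable fun x => ψ x θ l)
    (hψc : ∀ x l, ContinuousOn (fun θ => ψ x θ l) (Metric.closedBall θ₀ δ)) :
    ∃ T : (n : ℕ) → (Fin n → 𝒳) → E p, (∀ n, Measurable (T n)) ∧
      ∀ n (x : Fin n → 𝒳),
        (∀ z₁ ∈ Metric.closedBall (θ₀, (0 : Fin r → ℝ)) δ,
          ∀ z₂ ∈ Metric.closedBall (θ₀, (0 : Fin r → ℝ)) δ,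
          ‖estEq (avgScore ψ x) Mf m z₁ - estEq (avgScore ψ x) Mf m z₂ - A (z₁ - z₂)‖
            ≤ c * ‖z₁ - z₂‖) →
        2 * ‖A.symm (avgScore ψ x θ₀, 0)‖ ≤ δ →
        ∃ lam, estEq (avgScore ψ x) Mf m (T n x, lam) = 0 ∧
          ‖T n x - θ₀‖ ≤ 2 * ‖A.symm (avgScore ψ x θ₀, 0)‖ := by
  set z₀ : E p × (Fin r → ℝ) := (θ₀, 0) with hz₀
  set ρ := ballRetract z₀ δ with hρ
  have hρ1 : ∀ z, (ρ z).1 ∈ Metric.closedBall θ₀ δ := fun z => by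
    have := ballRetract_mem (z₀ := z₀) hδ z
    rw [hz₀, ← closedBall_prod_same] at this
    exact this.1
  have hρc : Continuous ρ := continuous_ballRetract hδ
  have hρc1 : Continuous fun z => (ρ z).1 := continuous_fst.comp hρc
  -- The retraction extends the Newton step from the ball to a map continuous in `z` on the whole
  -- space. Being also measurable in `x`, it is jointly measurable (Carathéodory).
  let step : (n : ℕ) → (E p × (Fin r → ℝ)) → (Fin n → 𝒳) → (E p × (Fin r → ℝ)) := fun n z x =>
    ρ z - A.symm (estEq (avgScore ψ x) Mf m (ρ z))
  have hstep_cont : ∀ n (x : Fin n → 𝒳), Continuous fun z => step n z x := by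
    intro n x
    refine hρc.sub (A.symm.continuous.comp (Continuous.prodMk (Continuous.add ?_ ?_) ?_))
    · refine continuous_pi fun l => continuous_const.mul (continuous_finsetSum _ fun i _ => ?_)
      exact (hψc (x i) l).comp_continuous hρc1 hρ1
    · exact (hMf.comp_continuous hρc1 hρ1).matrix_mulVec (continuous_snd.comp hρc)
    · exact hm.comp_continuous hρc1 hρ1
  have hstep_meas : ∀ n z, Measurable (step n z) := by
    intro n z
    refine measurable_const.sub (A.symm.continuous.measurable.comp
      (Measurable.prodMk (Measurable.add ?_ measurable_const) measurable_const))
    refine measurable_pi_lambda _ fun l => (Finset.measurable_sum _ fun i _ => ?_).const_mul _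
    exact (hψm _ (hρ1 z) l).comp (measurable_pi_apply i)
  have hunc : ∀ n, Measurable (Function.uncurry (step n)) := fun n =>
    measurable_uncurry_of_continuous_of_measurable (hstep_cont n) (hstep_meas n)
  let iter : (n : ℕ) → ℕ → (Fin n → 𝒳) → (E p × (Fin r → ℝ)) := fun n k x =>
    (fun z => step n z x)^[k] z₀
  -- Measurability of `limUnder` holds for all samples, including those where the iteration does not
  -- converge and the value is a default one.
  have hlim : ∀ n, StronglyMeasurable fun x => limUnder atTop fun k => iter n k x := fun n =>
    StronglyMeasurable.limUnder fun k => (measurable_iterate (hunc n) z₀ k).stronglyMeasurable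
  refine ⟨fun n x => (limUnder atTop fun k => iter n k x).1, fun n => ?_, ?_⟩
  · exact measurable_fst.comp (hlim n).measurable
  · intro n x happ hsmall
    have hF₀ : estEq (avgScore ψ x) Mf m z₀ = (avgScore ψ x θ₀, 0) := by
      simp [estEq, hz₀, hm₀]
    rw [← hF₀] at hsmall ⊢
    obtain ⟨z, hz, hzero, htend⟩ := exists_zero_tendsto_iterate hδ.le hA happ hsmall
      (g := fun z => step n z x) (fun z hz => by simp only [step, hρ, ballRetract_eq hδ hz])
    have hl : limUnder atTop (fun k => iter n k x) = z := htend.limUnder_eq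
    simp only [hl]
    refine ⟨z.2, hzero, ?_⟩
    have := (norm_sub_le_of_zero hc hA (happ z hz z₀ (Metric.mem_closedBall_self hδ.le)) hzero).1
    exact (le_max_left _ _).trans this

/-! ### First order expansion of a root -/

/-- Near `θ₀`, a root of the restricted estimating equations is approximated by a linear function of
the score at `θ₀`. -/
lemma exists_root_expansion {J : Matrix (Fin p) (Fin p) ℝ}
    {A : (E p × (Fin r → ℝ)) ≃L[ℝ] ((Fin p → ℝ) × (Fin r → ℝ))}
    {Mf : E p → Matrix (Fin p) (Fin r) ℝ} {m : E p → Fin r → ℝ} {θ₀ : E p} {c δ L : ℝ} (hδ : 0 < δ)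
    (hc : 0 ≤ c) (hL : 0 ≤ L)
    (hAz : ∀ z, A z = (-J.mulVec z.1.ofLp + (Mf θ₀).mulVec z.2,
      (Mf θ₀).transpose.mulVec z.1.ofLp))
    (hA : ‖(A.symm : ((Fin p → ℝ) × (Fin r → ℝ)) →L[ℝ] (E p × (Fin r → ℝ)))‖ * c ≤ 1 / 2) (hm₀ : m θ₀ = 0)
    (hMf : ∀ θ₁ ∈ Metric.closedBall θ₀ δ, ∀ θ₂ ∈ Metric.closedBall θ₀ δ, ∀ j l,
      |Mf θ₁ j l - Mf θ₂ j l| ≤ L * ‖θ₁ - θ₂‖) :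
    ∃ η > 0, ∀ s : E p → Fin p → ℝ,
      (∀ θ₁ ∈ Metric.closedBall θ₀ δ, ∀ θ₂ ∈ Metric.closedBall θ₀ δ,
        ‖s θ₁ - s θ₂ + J.mulVec (θ₁ - θ₂).ofLp‖ ≤ c * ‖θ₁ - θ₂‖) →
      (∀ z₁ ∈ Metric.closedBall (θ₀, (0 : Fin r → ℝ)) δ,
        ∀ z₂ ∈ Metric.closedBall (θ₀, (0 : Fin r → ℝ)) δ,
        ‖estEq s Mf m z₁ - estEq s Mf m z₂ - A (z₁ - z₂)‖ ≤ c * ‖z₁ - z₂‖) →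
      ‖s θ₀‖ < η → ∀ θ lam, ‖θ - θ₀‖ < η → estEq s Mf m (θ, lam) = 0 →
        ‖θ - θ₀ + (A.symm (s θ₀, 0)).1‖
          ≤ 2 * c * ‖(A.symm : ((Fin p → ℝ) × (Fin r → ℝ)) →L[ℝ] (E p × (Fin r → ℝ)))‖ ^ 2 * ‖s θ₀‖ := by
  set a := ‖(A.symm : ((Fin p → ℝ) × (Fin r → ℝ)) →L[ℝ] (E p × (Fin r → ℝ)))‖ with ha
  set b := ‖(A : (E p × (Fin r → ℝ)) →L[ℝ] ((Fin p → ℝ) × (Fin r → ℝ)))‖ with hb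
  have ha0 : 0 ≤ a := norm_nonneg _
  have hb0 : 0 ≤ b := norm_nonneg _
  -- The three bounds place `θ` in the ball, allow the term `(M(θ₀) - M(θ))λ` to be absorbed into
  -- `‖λ‖ / 2`, and make the resulting bound on `‖λ‖` at most `δ`.
  set η := min δ (min (1 / (2 * (a * r * L + 1))) (δ / (2 * a * (1 + b + c) + 1))) with hη
  have hη0 : 0 < η := by positivity
  refine ⟨η, hη0, fun s hs happ hs₀ θ lam hθ hroot => ?_⟩
  have hηδ : η ≤ δ := min_le_left _ _
  have hη1 : a * r * L * η ≤ 1 / 2 := by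
    have h1 : η ≤ 1 / (2 * (a * r * L + 1)) := (min_le_right _ _).trans (min_le_left _ _)
    rw [le_div_iff₀ (by positivity)] at h1
    nlinarith
  have hη2 : 2 * a * (1 + b + c) * η ≤ δ := by
    have h1 : η ≤ δ / (2 * a * (1 + b + c) + 1) := (min_le_right _ _).trans (min_le_right _ _)
    rw [le_div_iff₀ (by positivity)] at h1
    nlinarith
  have hθm : θ ∈ Metric.closedBall θ₀ δ := mem_closedBall_iff_norm.2 (hθ.le.trans hηδ)
  have hθ₀m : θ₀ ∈ Metric.closedBall θ₀ δ := Metric.mem_closedBall_self hδ.le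
  have hroot1 : s θ + (Mf θ).mulVec lam = 0 := congrArg Prod.fst hroot
  have hJ : ‖J.mulVec (θ - θ₀).ofLp‖ ≤ b * ‖θ - θ₀‖ := by
    have h1 := (A : (E p × (Fin r → ℝ)) →L[ℝ] ((Fin p → ℝ) × (Fin r → ℝ))).le_opNorm (θ - θ₀, 0)
    have h2 : ‖((θ - θ₀, 0) : E p × (Fin r → ℝ))‖ = ‖θ - θ₀‖ := by simp [Prod.norm_def]
    rw [h2] at h1
    refine le_trans ?_ h1
    refine le_trans (le_of_eq ?_) (norm_fst_le _)
    simp [hAz]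
  have hsθ : ‖s θ‖ ≤ (1 + b + c) * η := by
    have h1 := hs θ hθm θ₀ hθ₀m
    have h2 : s θ = (s θ - s θ₀ + J.mulVec (θ - θ₀).ofLp) + s θ₀ - J.mulVec (θ - θ₀).ofLp := by abel
    have h3 : ‖s θ‖ ≤ ‖s θ - s θ₀ + J.mulVec (θ - θ₀).ofLp‖ + ‖s θ₀‖
        + ‖J.mulVec (θ - θ₀).ofLp‖ := by
      conv_lhs => rw [h2]
      exact (norm_sub_le _ _).trans (by gcongr; exact norm_add_le _ _)
    have h4 : c * ‖θ - θ₀‖ ≤ c * η := mul_le_mul_of_nonneg_left hθ.le hc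
    have h5 : b * ‖θ - θ₀‖ ≤ b * η := mul_le_mul_of_nonneg_left hθ.le hb0
    linarith
  -- The multiplier is not assumed small. As `A(0, λ) = (M(θ₀)λ, 0)`, its norm is at most `a *
  -- ‖M(θ₀)λ‖`, and `M(θ₀)λ` is close to `M(θ)λ = -s(θ)`, which is small.
  have hlam : ‖lam‖ ≤ δ := by
    have h1 : ((0, lam) : E p × (Fin r → ℝ)) = A.symm ((Mf θ₀).mulVec lam, 0) := by
      rw [ContinuousLinearEquiv.eq_symm_apply, hAz]
      simp
    have h2 : ‖lam‖ ≤ a * ‖(Mf θ₀).mulVec lam‖ := by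
      have h3 := (A.symm : ((Fin p → ℝ) × (Fin r → ℝ)) →L[ℝ] (E p × (Fin r → ℝ))).le_opNorm ((Mf θ₀).mulVec lam, 0)
      have h4 : ‖(((Mf θ₀).mulVec lam, 0) : (Fin p → ℝ) × (Fin r → ℝ))‖ = ‖(Mf θ₀).mulVec lam‖ := by
        simp [Prod.norm_def]
      rw [h4, ContinuousLinearEquiv.coe_coe, ← h1] at h3
      exact (norm_snd_le ((0, lam) : E p × (Fin r → ℝ))).trans h3
    have h5 : ‖(Mf θ₀ - Mf θ).mulVec lam‖ ≤ r * (L * η) * ‖lam‖ := by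
      refine norm_mulVec_le (by positivity) (fun j l => ?_) lam
      refine (hMf θ₀ hθ₀m θ hθm j l).trans (mul_le_mul_of_nonneg_left ?_ hL)
      rw [norm_sub_rev]
      exact hθ.le
    have h6 : (Mf θ₀).mulVec lam = -s θ + (Mf θ₀ - Mf θ).mulVec lam := by
      rw [Matrix.sub_mulVec, ← eq_neg_of_add_eq_zero_right hroot1]
      abel
    have h7 : ‖(Mf θ₀).mulVec lam‖ ≤ ‖s θ‖ + r * (L * η) * ‖lam‖ := by
      rw [h6]
      refine (norm_add_le _ _).trans (add_le_add ?_ h5)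
      rw [norm_neg]
    have h8 : a * ‖(Mf θ₀).mulVec lam‖ ≤ a * (‖s θ‖ + r * (L * η) * ‖lam‖) :=
      mul_le_mul_of_nonneg_left h7 ha0
    have h9 : a * r * L * η * ‖lam‖ ≤ 1 / 2 * ‖lam‖ :=
      mul_le_mul_of_nonneg_right hη1 (norm_nonneg _)
    have h10 : a * ‖s θ‖ ≤ a * ((1 + b + c) * η) := mul_le_mul_of_nonneg_left hsθ ha0
    linarith
  have hz : (θ, lam) ∈ Metric.closedBall (θ₀, (0 : Fin r → ℝ)) δ := by
    rw [← closedBall_prod_same]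
    exact ⟨hθm, by simpa using hlam⟩
  have hz₀ := Metric.mem_closedBall_self (x := (θ₀, (0 : Fin r → ℝ))) hδ.le
  have hF₀ : estEq s Mf m (θ₀, 0) = (s θ₀, 0) := by simp [estEq, hm₀]
  have hfin := (norm_sub_le_of_zero hc hA (happ _ hz _ hz₀) hroot).2
  rw [hF₀] at hfin
  have hAs : ‖A.symm (s θ₀, 0)‖ ≤ a * ‖s θ₀‖ := by
    have h3 := (A.symm : ((Fin p → ℝ) × (Fin r → ℝ)) →L[ℝ] (E p × (Fin r → ℝ))).le_opNorm (s θ₀, 0)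
    have h4 : ‖((s θ₀, 0) : (Fin p → ℝ) × (Fin r → ℝ))‖ = ‖s θ₀‖ := by simp [Prod.norm_def]
    rwa [h4] at h3
  calc ‖θ - θ₀ + (A.symm (s θ₀, 0)).1‖
      ≤ ‖((θ, lam) : E p × (Fin r → ℝ)) - (θ₀, 0) + A.symm (s θ₀, 0)‖ := le_max_left _ _
    _ ≤ a * c * (2 * ‖A.symm (s θ₀, 0)‖) := hfin
    _ ≤ a * c * (2 * (a * ‖s θ₀‖)) := by gcongr
    _ = 2 * c * a ^ 2 * ‖s θ₀‖ := by ring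

lemma dotProduct_mulVec_eq_integral {Q : Measure 𝒳} {u : 𝒳 → Fin p → ℝ}
    (hu : ∀ l, MemLp (fun x => u x l) 2 Q) {K : Matrix (Fin p) (Fin p) ℝ}
    (hK : ∀ k l, ∫ x, u x k * u x l ∂Q = K k l) (t : Fin p → ℝ) :
    ∫ x, (∑ k, u x k * t k) ^ 2 ∂Q = t ⬝ᵥ K.mulVec t := by
  have hint : ∀ k l, Integrable (fun x => u x k * t k * (u x l * t l)) Q := fun k l =>
    ((hu k).mul_const (t k)).integrable_mul ((hu l).mul_const (t l))
  simp only [pow_two, Finset.sum_mul_sum]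
  rw [integral_finsetSum _ fun k _ => integrable_finsetSum _ fun l _ => hint k l]
  simp only [dotProduct, Matrix.mulVec, Finset.mul_sum]
  refine Finset.sum_congr rfl fun k _ => ?_
  rw [integral_finsetSum _ fun l _ => hint k l]
  refine Finset.sum_congr rfl fun l _ => ?_
  have e : ∀ x, u x k * t k * (u x l * t l) = t k * t l * (u x k * u x l) := fun x => by ring
  simp only [e]
  rw [integral_const_mul, hK]
  ring

/-- The quadratic form of `K` at `t` is the integral of the square of `∑ u_k t_k`. -/
lemma posSemidef_of_eq_integral {Q : Measure 𝒳} {u : 𝒳 → Fin p → ℝ}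
    (hu : ∀ l, MemLp (fun x => u x l) 2 Q) {K : Matrix (Fin p) (Fin p) ℝ}
    (hK : ∀ k l, ∫ x, u x k * u x l ∂Q = K k l) : K.PosSemidef := by
  refine Matrix.PosSemidef.of_dotProduct_mulVec_nonneg ?_ fun t => ?_
  · ext k l
    simp only [Matrix.conjTranspose_apply, star_trivial, ← hK, mul_comm]
  · simp only [star_trivial]
    rw [← dotProduct_mulVec_eq_integral hu hK]
    exact integral_nonneg fun x => sq_nonneg _

/-! ### Asymptotic normality -/

section Normality

variable {Ω : Type*} [MeasurableSpace Ω] {P : Measure Ω} [IsProbabilityMeasure P] {Q : Measure 𝒳}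
  {X : ℕ → Ω → 𝒳}

/-- Central limit theorem for the score at the true parameter. -/
lemma tendstoInDistribution_avgScore (hX : ∀ i, Measurable (X i)) (hindep : iIndepFun X P)
    (hlaw : ∀ i, P.map (X i) = Q) {ψ : 𝒳 → E p → Fin p → ℝ} {θ₀ : E p} {S : Set 𝒳}
    (hS : ∀ᵐ x ∂Q, x ∈ S) (hmeas : ∀ l, Measurable (S.indicator fun x => ψ x θ₀ l))
    (hL2 : ∀ l, MemLp (fun x => ψ x θ₀ l) 2 Q) (hmean : ∀ l, ∫ x, ψ x θ₀ l ∂Q = 0)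
    {K : Matrix (Fin p) (Fin p) ℝ} (hK : ∀ k l, ∫ x, ψ x θ₀ k * ψ x θ₀ l ∂Q = K k l) :
    TendstoInDistribution
      (fun (n : ℕ) ω => √(n : ℝ) •
        (WithLp.toLp 2 (avgScore ψ (fun i : Fin n => X i ω) θ₀) : E p)) atTop
      (id : E p → E p) (fun _ => P) (multivariateGaussian 0 K) := by
  have hQ : IsProbabilityMeasure Q := by
    rw [← hlaw 0]; exact Measure.isProbabilityMeasure_map (hX 0).aemeasurable
  -- Cutting the score off outside `S` makes it measurable everywhere, and almost surely changes no
  -- observation.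
  set v : 𝒳 → E p := fun x => WithLp.toLp 2 fun l => S.indicator (fun x => ψ x θ₀ l) x with hv
  have hvm : Measurable v :=
    (PiLp.continuous_toLp 2 _).measurable.comp (measurable_pi_lambda _ hmeas)
  have hident : ∀ i, IdentDistrib (X i) (X 0) P P := fun i =>
    ⟨(hX i).aemeasurable, (hX 0).aemeasurable, by rw [hlaw, hlaw]⟩
  have hinner : ∀ t : E p, (fun x => inner ℝ (v x) t) =ᵐ[Q] fun x => ∑ k, ψ x θ₀ k * t k := by
    intro t
    filter_upwards [hS] with x hx
    simp [hv, PiLp.inner_apply, hx, mul_comm]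
  have hL2' : ∀ t : E p, MemLp (fun x => ∑ k, ψ x θ₀ k * t k) 2 Q := fun t =>
    memLp_finsetSum _ fun k _ => (hL2 k).mul_const (t k)
  have hmt : ∀ t : E p, Measurable fun x => inner ℝ (v x) t := fun t =>
    hvm.inner measurable_const
  have hclt := tendstoInDistribution_inv_sqrt_smul_sum (P := P) (ξ := fun i ω => v (X i ω))
    (S := K) (posSemidef_of_eq_integral hL2 hK) (hindep.comp (fun _ => v) fun _ => hvm)
    (fun i => (hident i).comp hvm)
    (fun t => by
      have h : MemLp (fun x => inner ℝ (v x) t) 2 (P.map (X 0)) := by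
        rw [hlaw 0]; exact (memLp_congr_ae (hinner t)).2 (hL2' t)
      exact h.comp_of_map (hX 0).aemeasurable)
    (fun t => by
      rw [← integral_map (hX 0).aemeasurable (f := fun x => inner ℝ (v x) t)
        (hmt t).aestronglyMeasurable, hlaw 0, integral_congr_ae (hinner t),
        integral_finsetSum _ fun k _ => ((hL2 k).integrable (by norm_num)).mul_const (t k)]
      simp [integral_mul_const, hmean])
    (fun t => by
      rw [← integral_map (hX 0).aemeasurable (f := fun x => (inner ℝ (v x) t) ^ 2)
        ((hmt t).pow_const 2).aestronglyMeasurable, hlaw 0,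
        ← dotProduct_mulVec_eq_integral hL2 hK]
      refine integral_congr_ae ?_
      filter_upwards [hinner t] with x hx
      simp only [hx])
  refine hclt.congr (fun n => ?_) (ae_eq_refl _)
  have hS' : ∀ᵐ ω ∂P, ∀ i, X i ω ∈ S :=
    ae_all_iff.2 fun i => ae_of_ae_map (hX i).aemeasurable (by rw [hlaw i]; exact hS)
  filter_upwards [hS'] with ω hω
  ext l
  have hsq : √(n : ℝ) * (n : ℝ)⁻¹ = (√(n : ℝ))⁻¹ := by
    rw [← div_eq_mul_inv, Real.sqrt_div_self]
  simp only [PiLp.smul_apply, smul_eq_mul, avgScore]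
  rw [← mul_assoc, hsq, Finset.sum_range fun i => v (X i ω)]
  congr 1
  simp [hv, hω]

/-- A sequence with the same first order expansion as `T s_n`, where `√n s_n` is asymptotically
normal, is asymptotically normal. -/
lemma tendstoInDistribution_of_expansion {s : ℕ → Ω → E p} {K T : Matrix (Fin p) (Fin p) ℝ}
    (hK : K.PosSemidef)
    (hs : TendstoInDistribution (fun (n : ℕ) ω => √(n : ℝ) • s n ω) atTop (id : E p → E p)
      (fun _ => P) (multivariateGaussian 0 K)) {Y : ℕ → Ω → E p} (hY : ∀ n, AEMeasurable (Y n) P)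
    (hexp : ∀ c > 0, HighProb P fun n ω =>
      ‖Y n ω - WithLp.toLp 2 (T.mulVec (s n ω).ofLp)‖ ≤ c * ‖s n ω‖) :
    TendstoInDistribution (fun (n : ℕ) ω => √(n : ℝ) • Y n ω) atTop (id : E p → E p)
      (fun _ => P) (multivariateGaussian 0 (T * K * T.transpose)) := by
  set g : E p → E p := fun x => WithLp.toLp 2 (T.mulVec x.ofLp) with hg
  have hgc : Continuous g := by fun_prop
  have hmap : (multivariateGaussian 0 K).map (g ∘ id) =
      (multivariateGaussian 0 (T * K * T.transpose)).map id := by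
    rw [Measure.map_id]
    exact multivariateGaussian_map_mulVec hK
  have h1 := hs.continuous_comp hgc
  have h2 : TendstoInDistribution (fun (n : ℕ) => g ∘ fun ω => √(n : ℝ) • s n ω) atTop
      (id : E p → E p) (fun _ => P) (multivariateGaussian 0 (T * K * T.transpose)) := by
    refine ⟨h1.forall_aemeasurable, by fun_prop, ?_⟩
    have h3 := h1.tendsto
    simp only [hmap] at h3
    exact h3
  refine tendstoInDistribution_of_tendstoInMeasure_sub _ _ h2
    (tendstoInMeasure_zero_of_norm_le hs fun c hc => (hexp c hc).mono
      (Eventually.of_forall fun ω n hn => ?_))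
    fun n => (measurable_const_smul (√(n : ℝ))).comp_aemeasurable (hY n)
  have e : √(n : ℝ) • Y n ω - g (√(n : ℝ) • s n ω) = √(n : ℝ) • (Y n ω - g (s n ω)) := by
    simp only [hg, WithLp.ofLp_smul, Matrix.mulVec_smul, WithLp.toLp_smul, smul_sub]
  simp only [Pi.sub_apply, Function.comp_apply]
  rw [e, norm_smul, norm_smul, mul_left_comm]
  exact mul_le_mul_of_nonneg_left hn (norm_nonneg _)

end Normality

end Bregman

end

/-! ### Consistent roots and their limit law -/

theorem theorem3 {p r : ℕ} (hr : r < p)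
    {𝒳 : Type*} [MeasurableSpace 𝒳] (𝓕 : Bregman.Model p 𝒳)
    (B : ℝ → ℝ) (hB : Bregman.IsGenerator B)
    -- the restrictions
    (m : Bregman.E p → Fin r → ℝ)
    (hm : ContDiffOn ℝ 1 m 𝓕.Θ)
    (hrank : ∀ θ ∈ 𝓕.Θ, (Bregman.constraintMatrix m θ).rank = r)
    -- the true parameter, and the neighbourhood of it on which the model is regular
    (θ₀ : Bregman.E p) (hθ₀ : θ₀ ∈ 𝓕.Θ) (hmθ₀ : m θ₀ = 0)
    (N : Set (Bregman.E p)) (hN : IsOpen N) (hNΘ : N ⊆ 𝓕.Θ) (hθ₀N : θ₀ ∈ N)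
    (hA1 : 𝓕.A1 (𝓕.f θ₀)) (hA2 : 𝓕.A2 N) (hA3 : 𝓕.A3 B (𝓕.f θ₀) N)
    (hA4 : 𝓕.A4 B (𝓕.f θ₀) θ₀) (hA5 : 𝓕.A5 B (𝓕.f θ₀) N) (hA6 : Bregman.A6 m N)
    (hK : 𝓕.FiniteK B (𝓕.f θ₀) θ₀)
    -- an i.i.d. sample from the density `f_θ₀`
    {Ω : Type*} [MeasurableSpace Ω] (P : Measure Ω) [IsProbabilityMeasure P]
    (X : ℕ → Ω → 𝒳) (hX : ∀ i, Measurable (X i)) (hindep : iIndepFun X P)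
    (hlaw : ∀ i, P.map (X i) = 𝓕.dist (𝓕.f θ₀)) :
    (∃ T : (n : ℕ) → (Fin n → 𝒳) → Bregman.E p, (∀ n, Measurable (T n)) ∧
      Bregman.IsConsistentRootSeq P 𝓕 B m X θ₀ (fun n ω => T n (fun i : Fin n => X i ω))) ∧
    ∀ est : ℕ → Ω → Bregman.E p, (∀ n, AEMeasurable (est n) P) →
      Bregman.IsConsistentRootSeq P 𝓕 B m X θ₀ est →
      TendstoInDistribution (fun (n : ℕ) ω => √(n : ℝ) • (est n ω - θ₀)) atTop
        (id : Bregman.E p → Bregman.E p) (fun _ => P)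
        (multivariateGaussian 0
          (Bregman.Sigmamat (𝓕.J B (𝓕.f θ₀) θ₀) (𝓕.K B (𝓕.f θ₀) θ₀)
            (Bregman.constraintMatrix m θ₀))) := by
  set Q := 𝓕.dist (𝓕.f θ₀) with hQ
  set J := 𝓕.J B (𝓕.f θ₀) θ₀ with hJdef
  set K := 𝓕.K B (𝓕.f θ₀) θ₀ with hKdef
  set M := Bregman.constraintMatrix m θ₀ with hMdef
  have hQprob : IsProbabilityMeasure Q := Bregman.Model.isProbabilityMeasure_dist hθ₀
  have hJpd : J.PosDef := by
    rw [hJdef, Bregman.Model.J_eq_hessianV hB hN hNΘ hθ₀N hA1 hA2 hA3]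
    exact hA4
  have hJsymm : J.transpose = J := by
    simpa [Matrix.conjTranspose_eq_transpose_of_trivial] using hJpd.isHermitian.eq
  obtain ⟨hL2, hmean, hcov⟩ := Bregman.Model.psi_moments hB hN hNΘ hθ₀N hA1 hA2 hA3 hK
  obtain ⟨S, hSm, hS, hψm, D, hD, hexp⟩ :=
    Bregman.Model.exists_regular_set hB hN hNΘ hθ₀N hA1 hA2 hA3 hA5
  have hhess := Bregman.Model.integrable_and_integral_hessian hB hN hNΘ hθ₀N hA1 hA2 hA3
  obtain ⟨A, hA, hAsymm⟩ := Bregman.exists_linearization hJpd (hrank θ₀ hθ₀)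
  set a := ‖(A.symm : ((Fin p → ℝ) × (Fin r → ℝ)) →L[ℝ] (Bregman.E p × (Fin r → ℝ)))‖ with ha
  have ha0 : 0 ≤ a := norm_nonneg _
  have hS' : ∀ᵐ ω ∂P, ∀ i, X i ω ∈ S :=
    ae_all_iff.2 fun i => ae_of_ae_map (hX i).aemeasurable (by rw [hlaw i]; exact hS)
  obtain ⟨δ₀, hδ₀, hcube₀⟩ := Bregman.exists_cube_subset hN hθ₀N
  obtain ⟨L, hL, hLip⟩ := hA6.exists_lipschitz hcube₀
  have hball₀ : ∀ δ < δ₀, Metric.closedBall θ₀ δ ⊆ Bregman.cube θ₀ δ₀ := fun δ hδ =>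
    (Metric.closedBall_subset_ball hδ).trans (Bregman.ball_subset_cube _ _)
  have hMf : ∀ δ < δ₀, ∀ θ₁ ∈ Metric.closedBall θ₀ δ, ∀ θ₂ ∈ Metric.closedBall θ₀ δ, ∀ j l,
      |Bregman.constraintMatrix m θ₁ j l - Bregman.constraintMatrix m θ₂ j l|
        ≤ L * ‖θ₁ - θ₂‖ := fun δ hδ θ₁ h₁ θ₂ h₂ =>
    hLip θ₁ (hball₀ δ hδ h₁) θ₂ (hball₀ δ hδ h₂)
  have hmc : ContDiffAt ℝ 1 m θ₀ := hm.contDiffAt (𝓕.isOpen.mem_nhds hθ₀)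
  have hint : ∀ l, Integrable (fun x => 𝓕.psi B x θ₀ l) Q := fun l =>
    (hL2 l).integrable (by norm_num)
  have hsmall : ∀ ε > 0, Bregman.HighProb P fun n ω =>
      ‖Bregman.avgScore (𝓕.psi B) (fun i : Fin n => X i ω) θ₀‖ < ε := fun ε hε =>
    Bregman.highProb_norm_avgScore_lt hX hindep hlaw hint hmean hε
  -- near linearity of the estimating equations, with probability tending to one
  have happrox : ∀ c > 0, ∃ δ > 0, δ < δ₀ ∧ Bregman.HighProb P fun n ω =>
      (∀ θ₁ ∈ Metric.closedBall θ₀ δ, ∀ θ₂ ∈ Metric.closedBall θ₀ δ,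
        ‖Bregman.avgScore (𝓕.psi B) (fun i : Fin n => X i ω) θ₁
          - Bregman.avgScore (𝓕.psi B) (fun i : Fin n => X i ω) θ₂
          + J.mulVec (θ₁ - θ₂).ofLp‖ ≤ c * ‖θ₁ - θ₂‖) ∧
      ∀ z₁ ∈ Metric.closedBall (θ₀, (0 : Fin r → ℝ)) δ,
        ∀ z₂ ∈ Metric.closedBall (θ₀, (0 : Fin r → ℝ)) δ,
        ‖Bregman.estEq (Bregman.avgScore (𝓕.psi B) (fun i : Fin n => X i ω))
            (Bregman.constraintMatrix m) m z₁
          - Bregman.estEq (Bregman.avgScore (𝓕.psi B) (fun i : Fin n => X i ω))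
            (Bregman.constraintMatrix m) m z₂ - A (z₁ - z₂)‖ ≤ c * ‖z₁ - z₂‖ := by
    intro c hc
    obtain ⟨δ₁, hδ₁, h₁⟩ := Bregman.exists_highProb_avgScore_approx hX hindep hlaw hS hN hθ₀N
      (H := fun k l x => Bregman.paramDeriv k (Bregman.paramDeriv l (𝓕.V B)) θ₀ x) (J := J) hD
      (fun k l => (hhess k l).1)
      -- The expansion pairs the row index of `J` with the inner derivative, which transposes it.
      -- Symmetry of `J` is part of its positive definiteness.
      (fun l k => by rw [(hhess k l).2, ← hJdef, ← Matrix.transpose_apply J, hJsymm]) hexp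
      (half_pos hc)
    obtain ⟨δ₂, hδ₂, h₂⟩ := Bregman.exists_estEq_approx (J := J) (half_pos hδ₀) hL
      (hMf _ (half_lt_self hδ₀)) (fun c hc => Bregman.exists_constraint_approx hmc hc) hA hc
    refine ⟨min (min δ₁ δ₂) (δ₀ / 2), by positivity,
      (min_le_right _ _).trans_lt (half_lt_self hδ₀), ?_⟩
    refine (h₁ (min (min δ₁ δ₂) (δ₀ / 2)) ((min_le_left _ _).trans (min_le_left _ _))).mono
      (Eventually.of_forall fun ω n hn => ⟨fun θ₁ h₁ θ₂ h₂ => ?_, ?_⟩)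
    · exact (hn θ₁ h₁ θ₂ h₂).trans
        (mul_le_mul_of_nonneg_right (half_le_self hc.le) (norm_nonneg _))
    · exact h₂ _ ((min_le_left _ _).trans (min_le_right _ _)) _ hn
  have hac : ∀ c, c ≤ 1 / (2 * (a + 1)) → a * c ≤ 1 / 2 := by
    intro c hc
    rw [le_div_iff₀ (by positivity)] at hc
    nlinarith
  refine ⟨?_, fun est hest hroot => ?_⟩
  · set c := 1 / (2 * (a + 1)) with hc
    have hc0 : 0 < c := by positivity
    obtain ⟨δ, hδ, hδδ₀, hHP⟩ := happrox c hc0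
    have hballN : Metric.closedBall θ₀ δ ⊆ N := (hball₀ δ hδδ₀).trans hcube₀
    -- Set to zero off `S`, the score is measurable in `x` and, for every `x`, continuous in `θ` on
    -- the ball.
    set ψ' : 𝒳 → Bregman.E p → Fin p → ℝ := fun x θ l => S.indicator (fun x => 𝓕.psi B x θ l) x
      with hψ'
    obtain ⟨T, hTm, hT⟩ := Bregman.exists_measurable_root (A := A)
      (Mf := Bregman.constraintMatrix m) (m := m) (ψ := ψ') hδ hc0.le (hac c le_rfl) hmθ₀
      (by
        refine continuousOn_pi.2 fun j => continuousOn_pi.2 fun l => ?_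
        refine (LipschitzOnWith.of_dist_le_mul (K := ⟨L, hL⟩) fun θ₁ h₁ θ₂ h₂ => ?_).continuousOn
        rw [dist_eq_norm θ₁]
        exact hMf δ hδδ₀ θ₁ h₁ θ₂ h₂ j l)
      (hm.continuousOn.mono (hballN.trans hNΘ))
      (fun θ hθ l => hψm θ (hballN hθ) l)
      (fun x l => by
        by_cases hx : x ∈ S
        · simp only [hψ', Set.indicator_of_mem hx]
          exact (Bregman.continuousOn_of_abs_sub_add_le fun θ₁ h₁ θ₂ h₂ =>
            hexp x hx δ₀ hδ₀ hcube₀ θ₁ h₁ θ₂ h₂ l).mono (hball₀ δ hδδ₀)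
        · simp only [hψ', Set.indicator_of_notMem hx]
          exact continuousOn_const)
    have havg : ∀ ω, (∀ i, X i ω ∈ S) → ∀ n, Bregman.avgScore ψ' (fun i : Fin n => X i ω)
        = Bregman.avgScore (𝓕.psi B) (fun i : Fin n => X i ω) := by
      intro ω hω n
      funext θ l
      simp [Bregman.avgScore, hψ', hω]
    have hAs : ∀ s : Fin p → ℝ, 2 * ‖A.symm (s, 0)‖ ≤ 2 * (a + 1) * ‖s‖ := by
      intro s
      have h3 := (A.symm : ((Fin p → ℝ) × (Fin r → ℝ)) →L[ℝ]
        (Bregman.E p × (Fin r → ℝ))).le_opNorm (s, 0)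
      have h4 : ‖((s, 0) : (Fin p → ℝ) × (Fin r → ℝ))‖ = ‖s‖ := by simp [Prod.norm_def]
      rw [h4, ContinuousLinearEquiv.coe_coe] at h3
      nlinarith [norm_nonneg s]
    have hmain : ∀ ε > 0, Bregman.HighProb P fun n ω =>
        Bregman.IsRestrictedRoot 𝓕 B m (fun i : Fin n => X i ω) (T n fun i : Fin n => X i ω) ∧
        ‖T n (fun i : Fin n => X i ω) - θ₀‖ < ε := by
      intro ε hε
      refine (hHP.and (hsmall (min δ ε / (2 * (a + 1))) (by positivity))).mono ?_
      filter_upwards [hS'] with ω hω n hns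
      obtain ⟨⟨-, hn⟩, hs⟩ := hns
      rw [lt_div_iff₀ (by positivity)] at hs
      rw [← havg ω hω] at hn hs
      have hs' : 2 * ‖A.symm (Bregman.avgScore ψ' (fun i : Fin n => X i ω) θ₀, 0)‖ < min δ ε :=
        (hAs _).trans_lt (by linarith)
      obtain ⟨lam, hzero, hnorm⟩ := hT n _ hn (hs'.le.trans (min_le_left _ _))
      rw [havg ω hω] at hzero
      refine ⟨⟨hNΘ (hballN ?_), congrArg Prod.snd hzero, lam, congrArg Prod.fst hzero⟩, ?_⟩
      · exact mem_closedBall_iff_norm.2 (hnorm.trans (hs'.le.trans (min_le_left _ _)))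
      · exact (hnorm.trans_lt hs').trans_le (min_le_right _ _)
    exact ⟨T, hTm, (hmain 1 one_pos).mono (Eventually.of_forall fun ω n h => h.1),
      Bregman.tendstoInMeasure_iff_highProb.2 fun ε hε =>
        (hmain ε hε).mono (Eventually.of_forall fun ω n h => h.2)⟩
  · set s : ℕ → Ω → Bregman.E p := fun n ω =>
      WithLp.toLp 2 (Bregman.avgScore (𝓕.psi B) (fun i : Fin n => X i ω) θ₀) with hs
    have hclt := Bregman.tendstoInDistribution_avgScore hX hindep hlaw hS (hψm θ₀ hθ₀N) hL2 hmean
      hcov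
    have hres := Bregman.tendstoInDistribution_of_expansion (s := s) (T := Bregman.Pmat J M)
      (Y := fun n ω => est n ω - θ₀) (Bregman.posSemidef_of_eq_integral hL2 hcov) hclt
      (fun n => (hest n).sub_const θ₀) ?_
    · rw [Bregman.Pmat_transpose hJpd] at hres
      exact hres
    intro c' hc'
    -- The first bound gives `a * c ≤ 1 / 2`, as the inversion requires. The second brings the error
    -- factor `2 * c * a ^ 2` of the root expansion below `c'`.
    set c := min (1 / (2 * (a + 1))) (c' / (2 * (a ^ 2 + 1))) with hc
    have hc0 : 0 < c := by positivity
    have hcc' : 2 * c * a ^ 2 ≤ c' := by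
      have h1 : c ≤ c' / (2 * (a ^ 2 + 1)) := min_le_right _ _
      rw [le_div_iff₀ (by positivity)] at h1
      nlinarith
    obtain ⟨δ, hδ, hδδ₀, hHP⟩ := happrox c hc0
    obtain ⟨η, hη, hexpand⟩ := Bregman.exists_root_expansion (J := J) (A := A)
      (Mf := Bregman.constraintMatrix m) (m := m) hδ hc0.le hL hA (hac c (min_le_left _ _)) hmθ₀
      (hMf δ hδδ₀)
    have hcons := Bregman.tendstoInMeasure_iff_highProb.1 hroot.2 η hη
    have hroot1 : Bregman.HighProb P fun n ω =>
      Bregman.IsRestrictedRoot 𝓕 B m (fun i : Fin n => X i ω) (est n ω) := hroot.1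
    refine ((hHP.and (hsmall η hη)).and (hcons.and hroot1)).mono
      (Eventually.of_forall fun ω n hn => ?_)
    obtain ⟨⟨⟨hn1, hn2⟩, hn3⟩, hn4, -, hn5, lam, hn6⟩ := hn
    have := hexpand _ hn1 hn2 hn3 (est n ω) lam hn4 (Prod.ext hn6 hn5)
    rw [hAsymm, ← sub_eq_add_neg] at this
    refine this.trans ?_
    -- The root expansion measures the score in the sup norm, the limit theorem in the larger
    -- Euclidean norm.
    have hns : ‖Bregman.avgScore (𝓕.psi B) (fun i : Fin n => X i ω) θ₀‖ ≤ ‖s n ω‖ :=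
      (pi_norm_le_iff_of_nonneg (norm_nonneg _)).2 fun l => PiLp.norm_apply_le (s n ω) l
    exact mul_le_mul hcc' hns (norm_nonneg _) hc'.le
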